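/- Let $\mathcal X$ be a finite population and $\mathcal O$ a finite nonempty set of $\ell=|\mathcal O|$ outcomes. Let $(i,o^*_i)$ be a random individual-outcome pair in $\mathcal X\times\mathcal O$ with law $D$. A predictor is a map $\tilde p:\mathcal X\to\Delta\mathcal O$ into the probability distributions on $\mathcal O$; the modeled outcome $\tilde o_i$ satisfies $\Pr[\tilde o_i=o\mid i]=\tilde p_i(o)$. Write $\delta(X,Y)=\max_A|\Pr[X\in A]-\Pr[Y\in A]|$ for the statistical distance, and $\delta(X,Y\mid Z)$ for the same quantity with probabilities conditioned on $Z$. For $\mathcal C\subseteq\{0,1\}^{\mathcal X}$ and $\varepsilon>0$, $\tilde p$ is $(\mathcal C,\varepsilon)$-multi-calibrated if $\delta\big((c_i,\tilde o_i,\tilde p_i),(c_i,o^*_i,\tilde p_i)\big)\le\varepsilon$ for every $c\in\mathcal C$, and strictly $(\mathcal C,\varepsilon)$-multi-calibrated if $\mathbb E\big[\max_{c\in\mathcal C}\delta\big((c_i,\tilde o_i),(c_i,o^*_i)\mid\tilde p_i\big)\big]\le\varepsilon$. Let $\mathsf{VC}(\mathcal C)$ be the VC dimension of $\mathcal C$,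 let $\log$ be the natural logarithm, and for $c>0$ put $$n_c=\left\lceil\left(\frac{c\,\ell}{\varepsilon}\right)^{\ell+c}+\left(\frac{\log\ell}{\varepsilon}\right)^{c}\,\mathsf{VC}(\mathcal C)\right\rceil .$$ By an algorithm with $n$ samples for $(\mathcal C,\mathcal O,\varepsilon)$ we mean a map from $(\mathcal X\times\mathcal O)^n$ to predictors; it does not depend on $D$. (1) There is an absolute constant $c>0$ such that for all $\mathcal X$, $\mathcal O$, $\mathcal C\subseteq\{0,1\}^{\mathcal X}$ and $\varepsilon>0$ there is an algorithm with $n_c$ samples that, for every law $D$, when given $n_c$ i.i.d. pairs with law $D$, outputs a $(\mathcal C,\varepsilon)$-multi-calibrated predictor with probability at least $9/10$. (2) For every $\mathcal X$ and every fixed $\mathcal C\subseteq\{0,1\}^{\mathcal X}$ there is a constant $c>0$ (depending on $\mathcal C$ only) such that for all $\mathcal O$ and $\varepsilon>0$ there is an algorithm with $n_c$ samples that, for every law $D$, when given $n_c$ i.i.d. pairs with law $D$, outputs a strictly $(\mathcal C,\varepsilon)$-multi-calibrated predictor with probability at least $9/10$. -/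

import Mathlib

open MeasureTheory

noncomputable section

/-- A predictor assigns to every individual in the population `X` a probability distribution
on the set `O` of outcomes. -/
abbrev Predictor (X O : Type*) [Fintype O] : Type _ := X → stdSimplex ℝ O

/-- The law of the pair `(i, õ)`, where `D` is the law of the pair `(i, o*)` and the modeled
outcome `õ` has conditional distribution `p i` given the individual `i`:
`Pr[i = j, õ = o] = Pr[i = j] * p j o`. -/
def modeledLaw {X O : Type*} [Fintype X] [Fintype O] [MeasurableSpace X] [MeasurableSpace O]
    (D : Measure (X × O)) (p : Predictor X O) : Measure (X × O) :=
  ∑ j : X, ∑ o : O,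
    (D (Prod.fst ⁻¹' {j}) * ENNReal.ofReal (p j o)) • Measure.dirac (j, o)

/-- The statistical distance `max_A |Pr[U ∈ A] - Pr[V ∈ A]|`, where `U` and `V` are the values
of `f` at a random point with law `μ` and at a random point with law `ν`, respectively. -/
def statDist {Ω α : Type*} [MeasurableSpace Ω] (μ ν : Measure Ω) (f : Ω → α) : ℝ :=
  ⨆ A : Set α, |μ.real (f ⁻¹' A) - ν.real (f ⁻¹' A)|

/-- The predictor `p` is `(C, ε)`-multi-calibrated: `(c_i, õ_i, p_i)` and `(c_i, o*_i, p_i)` are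
at statistical distance at most `ε` for each `c ∈ C`. -/
def MultiCalibrated {X O : Type*} [Fintype X] [Fintype O] [MeasurableSpace X] [MeasurableSpace O]
    (C : Finset (X → Bool)) (ε : ℝ) (D : Measure (X × O)) (p : Predictor X O) : Prop :=
  ∀ c ∈ C, statDist (modeledLaw D p) D (fun z => (c z.1, z.2, p z.1)) ≤ ε

/-- The event that the individual receives the prediction `v`. -/
def levelSet {X O : Type*} [Fintype O] (p : Predictor X O) (v : stdSimplex ℝ O) : Set (X × O) :=
  {z | p z.1 = v}

/-- The conditional statistical distance `δ((c_i, õ_i), (c_i, o*_i) | p_i = v)`. -/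
def condStatDist {X O : Type*} [Fintype X] [Fintype O] [MeasurableSpace X] [MeasurableSpace O]
    (D : Measure (X × O)) (p : Predictor X O) (c : X → Bool) (v : stdSimplex ℝ O) : ℝ :=
  statDist (ProbabilityTheory.cond (modeledLaw D p) (levelSet p v))
    (ProbabilityTheory.cond D (levelSet p v)) (fun z => (c z.1, z.2))

/-- The predictor `p` is strictly `(C, ε)`-multi-calibrated:
`E[max_{c ∈ C} δ((c_i, õ_i), (c_i, o*_i) | p_i)] ≤ ε`. -/
def StrictlyMultiCalibrated {X O : Type*} [Fintype X] [Fintype O] [MeasurableSpace X]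
    [MeasurableSpace O] (C : Finset (X → Bool)) (ε : ℝ) (D : Measure (X × O))
    (p : Predictor X O) : Prop :=
  ∫ z, (⨆ c : C, condStatDist D p (c : X → Bool) (p z.1)) ∂D ≤ ε

open Classical in
/-- The Vapnik–Chervonenkis dimension of a family `C` of `{0, 1}`-valued functions, i.e. that of
the family of the subsets of `X` that the members of `C` indicate. -/
def vcDimension {X : Type*} [Fintype X] (C : Finset (X → Bool)) : ℕ :=
  (C.image fun c => Finset.univ.filter fun j => c j = true).vcDim

/-- The number `(c ℓ / ε) ^ (ℓ + c) + (log ℓ / ε) ^ c * d`, rounded up to an integer. -/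
def sampleSize (c ε : ℝ) (l d : ℕ) : ℕ :=
  ⌈(c * l / ε) ^ ((l : ℝ) + c) + (Real.log l / ε) ^ c * d⌉₊

end

/-!
The learner runs multiplicative weights on the sample. The simplex of distributions on the `ℓ`
outcomes is divided into at most `(6 ℓ / ε) ^ ℓ` cells of small diameter, and predictions are
rounded to representatives of the cells. A test consists of a membership function and a set of
triples (cell, group membership, outcome). While some test tells the actual from the modeled
outcome on the sample with advantage more than `ε / 2`, the unrounded predictor is tilted by it,
which raises the log-likelihood of the sample by `ε ^ 2 / 64` per point. The log-likelihood starts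
at `-log ℓ` per point and is never positive, so `T = O(log ℓ / ε ^ 2)` updates suffice
(`exists_updates`).

The resulting predictor is determined by `T` tests. By the Sauer–Shelah lemma (`exists_cover`) the
family of pairs (predictor, test) shows few behaviours on `2 n` points, so symmetrization with a
ghost sample (`uniform_convergence`) bounds the advantages under the law by `ε`, with probability
`9 / 10` (`exists_learner`). The Sauer–Shelah count is used in the form `θ ^ (-d) (1 + θ) ^ (2 n)`
with `θ` of order `ε ^ 2 / T`, so that no logarithm of `n` enters and the VC dimension `d` gets a
coefficient polynomial in `log ℓ / ε`; the number of sets of triples, which is exponential in the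
number of cells, is paid for by the first term of the sample size.

Both notions of calibration reduce to bounds on advantages (`multiCalibrated_of_le`,
`strictlyMultiCalibrated_of_le`). For multi-calibration, the membership function is a member of
`C`. For strict multi-calibration, the maximum over `C` is taken for each prediction separately,
which amounts to membership functions that use one member of `C` for each cell. Their cover is the
power of that of `C` whose exponent is the number of cells, which multiplies `d` by this number;
the first term of the sample size absorbs the product when its constant is a multiple of `d + 1`.
-/

namespace MultiCalibration

/-! ### Uniform convergence -/

section UniformConvergence

/-- The probability weight of the sample `s` when its entries are independent, each with the
weight function `w`. -/
def sampleWeight {Z : Type*} {n : ℕ} (w : Z → ℝ) (s : Fin n → Z) : ℝ := ∏ k, w (s k)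

theorem sampleWeight_nonneg {Z : Type*} {n : ℕ} {w : Z → ℝ} (hw : ∀ z, 0 ≤ w z)
    (s : Fin n → Z) : 0 ≤ sampleWeight w s :=
  Finset.prod_nonneg fun _ _ => hw _

theorem sum_sampleWeight {Z : Type*} [Fintype Z] {n : ℕ} {w : Z → ℝ} (hw1 : ∑ z, w z = 1) :
    ∑ s : Fin n → Z, sampleWeight w s = 1 := by
  unfold sampleWeight
  rw [← Fintype.prod_sum (fun (_ : Fin n) z => w z)]
  simp [hw1]

/-- The doubled sample `t`, with the two entries exchanged at the places that `σ` marks. -/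
def swapSample {Z : Type*} {n : ℕ} (σ : Fin n → Bool) : (Fin n → Z × Z) ≃ (Fin n → Z × Z) :=
  Equiv.piCongrRight fun k => if σ k then Equiv.prodComm Z Z else Equiv.refl _

theorem swapSample_apply {Z : Type*} {n : ℕ} (σ : Fin n → Bool) (t : Fin n → Z × Z) (k : Fin n) :
    swapSample σ t k = if σ k then (t k).swap else t k := by
  unfold swapSample
  simp only [Equiv.piCongrRight_apply, Pi.map_apply]
  split <;> simp

/-- The points that occur in a doubled sample. -/
def samplePoints {Z : Type*} [DecidableEq Z] {n : ℕ} (t : Fin n → Z × Z) : Finset Z :=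
  Finset.univ.biUnion fun k => {(t k).1, (t k).2}

theorem samplePoints_swapSample {Z : Type*} [DecidableEq Z] {n : ℕ} (σ : Fin n → Bool)
    (t : Fin n → Z × Z) : samplePoints (swapSample σ t) = samplePoints t := by
  unfold samplePoints
  congr 1
  funext k
  rw [swapSample_apply]
  split
  · simp [Finset.pair_comm]
  · rfl

theorem card_samplePoints_le {Z : Type*} [DecidableEq Z] {n : ℕ} (t : Fin n → Z × Z) :
    (samplePoints t).card ≤ 2 * n := by
  refine Finset.card_biUnion_le.trans ?_
  refine (Finset.sum_le_card_nsmul _ _ 2 fun k _ => Finset.card_le_two).trans ?_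
  simp [mul_comm]

theorem exp_add_exp_neg_le (y : ℝ) : Real.exp y + Real.exp (-y) ≤ 2 * Real.exp (y ^ 2 / 2) := by
  have := Real.cosh_le_exp_half_sq y
  rw [Real.cosh_eq] at this
  linarith

/-- Averaging over the exchanges of a doubled sample: each pair contributes a hyperbolic cosine,
which is at most Gaussian. -/
theorem sum_swapSample_exp_le {Z : Type*} {n : ℕ} {g : Z → ℝ} (hg : ∀ z, |g z| ≤ 1) (a : ℝ)
    (t : Fin n → Z × Z) :
    ∑ σ : Fin n → Bool,
        ∏ k, Real.exp (a * (g (swapSample σ t k).2 - g (swapSample σ t k).1))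
      ≤ 2 ^ n * Real.exp (n * (2 * a ^ 2)) := by
  set F : Fin n → Bool → ℝ := fun k b =>
    if b then Real.exp (-(a * (g (t k).2 - g (t k).1)))
      else Real.exp (a * (g (t k).2 - g (t k).1)) with hF
  have h1 : ∀ σ : Fin n → Bool,
      ∏ k, Real.exp (a * (g (swapSample σ t k).2 - g (swapSample σ t k).1))
      = ∏ k, F k (σ k) := by
    intro σ
    refine Finset.prod_congr rfl fun k _ => ?_
    rw [swapSample_apply]
    simp only [hF]
    cases σ k
    · simp
    · simp only [if_true, Prod.fst_swap, Prod.snd_swap]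
      congr 1
      ring
  rw [Finset.sum_congr rfl fun σ _ => h1 σ, ← Fintype.prod_sum F]
  calc _ ≤ ∏ _k : Fin n, 2 * Real.exp (2 * a ^ 2) := by
        refine Finset.prod_le_prod (fun k _ => ?_) fun k _ => ?_
        · exact Finset.sum_nonneg fun b _ => by simp only [hF]; split <;> positivity
        · rw [Fintype.sum_bool]
          simp only [hF, if_true, Bool.false_eq_true, if_false]
          rw [add_comm]
          refine (exp_add_exp_neg_le _).trans ?_
          have h2 : (g (t k).2 - g (t k).1) ^ 2 ≤ 4 := by
            have h3 := abs_le.1 (hg (t k).2)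
            have h4 := abs_le.1 (hg (t k).1)
            nlinarith
          have h5 : (a * (g (t k).2 - g (t k).1)) ^ 2 / 2 ≤ 2 * a ^ 2 := by
            rw [mul_pow]
            nlinarith [sq_nonneg a]
          have := Real.exp_le_exp.2 h5
          linarith
    _ = _ := by
        rw [Finset.prod_const, mul_pow, ← Real.exp_nat_mul]
        simp

/-- Replacing the expectation by a second sample (Jensen's inequality for `exp`). -/
theorem prod_exp_le_sum_ghost {Z : Type*} [Fintype Z] {n : ℕ} {w : Z → ℝ} (hw : ∀ z, 0 ≤ w z)
    (hw1 : ∑ z, w z = 1) (g : Z → ℝ) (a : ℝ) (s : Fin n → Z) :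
    ∏ k, Real.exp (a * ((∑ z, w z * g z) - g (s k)))
      ≤ ∑ s' : Fin n → Z, sampleWeight w s' * ∏ k, Real.exp (a * (g (s' k) - g (s k))) := by
  have hJ : Real.exp (a * ∑ z, w z * g z) ≤ ∑ z, w z * Real.exp (a * g z) := by
    have := convexOn_exp.map_sum_le (t := Finset.univ) (w := w) (p := fun z => a * g z)
      (fun z _ => hw z) hw1 (fun z _ => Set.mem_univ _)
    simp only [smul_eq_mul] at this
    refine le_trans (le_of_eq ?_) this
    congr 1
    rw [Finset.mul_sum]
    exact Finset.sum_congr rfl fun z _ => by ring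
  calc _ ≤ ∏ k, ∑ z, w z * Real.exp (a * (g z - g (s k))) := by
        refine Finset.prod_le_prod (fun k _ => by positivity) fun k _ => ?_
        have : ∑ z, w z * Real.exp (a * (g z - g (s k)))
            = (∑ z, w z * Real.exp (a * g z)) * Real.exp (-(a * g (s k))) := by
          rw [Finset.sum_mul]
          refine Finset.sum_congr rfl fun z _ => ?_
          rw [mul_assoc, ← Real.exp_add]
          congr 2
          ring
        rw [this, mul_sub, sub_eq_add_neg, Real.exp_add]
        gcongr
    _ = _ := by
        rw [Fintype.prod_sum]
        refine Finset.sum_congr rfl fun s' _ => ?_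
        rw [Finset.prod_mul_distrib, sampleWeight]

/-- The moment bound behind uniform convergence: the sum of the exponential moments over a set
of representatives of the family on the doubled sample, averaged over the doubled samples. The
representatives depend only on the set of the points of the sample, hence not on exchanges. -/
theorem sum_doubled_sample_le {Z I : Type*} [Fintype Z] [DecidableEq Z] {n : ℕ} {w : Z → ℝ}
    (hw : ∀ z, 0 ≤ w z) (hw1 : ∑ z, w z = 1) {g : I → Z → ℝ} (hg : ∀ i z, |g i z| ≤ 1)
    {N : ℝ} (R : Finset Z → Finset I)
    (hR : ∀ U : Finset Z, U.card ≤ 2 * n → ((R U).card : ℝ) ≤ N) (a : ℝ) :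
    ∑ t : Fin n → Z × Z, (∏ k, w (t k).1 * w (t k).2) *
        ∑ r ∈ R (samplePoints t), ∏ k, Real.exp (a * (g r (t k).2 - g r (t k).1))
      ≤ N * Real.exp (n * (2 * a ^ 2)) := by
  set Φ : (Fin n → Z × Z) → ℝ := fun t =>
    ∑ r ∈ R (samplePoints t), ∏ k, Real.exp (a * (g r (t k).2 - g r (t k).1)) with hΦ
  set W : (Fin n → Z × Z) → ℝ := fun t => ∏ k, w (t k).1 * w (t k).2 with hW
  have hW0 : ∀ t, 0 ≤ W t := fun t =>
    Finset.prod_nonneg fun k _ => mul_nonneg (hw _) (hw _)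
  have hWσ : ∀ σ t, W (swapSample σ t) = W t := by
    intro σ t
    refine Finset.prod_congr rfl fun k _ => ?_
    rw [swapSample_apply]
    split
    · simp [mul_comm]
    · rfl
  have hW1 : ∑ t, W t = 1 := by
    rw [hW, ← Fintype.prod_sum (fun (_ : Fin n) (z : Z × Z) => w z.1 * w z.2),
      Fintype.sum_prod_type]
    simp [← Finset.mul_sum, hw1]
  have hsymm : ∀ σ : Fin n → Bool, ∑ t, W t * Φ (swapSample σ t) = ∑ t, W t * Φ t := by
    intro σ
    rw [← Equiv.sum_comp (swapSample σ) fun t => W t * Φ t]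
    simp only [hWσ]
  have havg : (2 : ℝ) ^ n * ∑ t, W t * Φ t
      = ∑ t, W t * ∑ σ : Fin n → Bool, Φ (swapSample σ t) := by
    simp only [Finset.mul_sum]
    rw [Finset.sum_comm' (t' := Finset.univ) (s' := fun _ => Finset.univ) (by simp)]
    rw [Finset.sum_congr rfl fun σ _ => hsymm σ]
    simp [Finset.mul_sum]
  have hbd : ∀ t, ∑ σ : Fin n → Bool, Φ (swapSample σ t)
      ≤ N * (2 ^ n * Real.exp (n * (2 * a ^ 2))) := by
    intro t
    simp only [hΦ, samplePoints_swapSample]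
    rw [Finset.sum_comm]
    refine (Finset.sum_le_card_nsmul _ _ _ fun r _ => sum_swapSample_exp_le (hg r) a t).trans ?_
    rw [nsmul_eq_mul]
    exact mul_le_mul_of_nonneg_right (hR _ (card_samplePoints_le t)) (by positivity)
  have h2 : (2 : ℝ) ^ n * ∑ t, W t * Φ t ≤ 2 ^ n * (N * Real.exp (n * (2 * a ^ 2))) := by
    rw [havg]
    calc _ ≤ ∑ t, W t * (N * (2 ^ n * Real.exp (n * (2 * a ^ 2)))) :=
          Finset.sum_le_sum fun t _ => mul_le_mul_of_nonneg_left (hbd t) (hW0 t)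
      _ = _ := by rw [← Finset.sum_mul, hW1]; ring
  exact le_of_mul_le_mul_left h2 (by positivity)

open Classical in
/-- **Uniform convergence.** If on any `2 n` points the functions `g i`, with values in `[-1, 1]`,
show at most `N` different behaviours, then with probability at least `1 - N exp (-n δ² / 8)`
no expectation of a `g i` exceeds its average over `n` independent samples by more than `δ`. -/
theorem uniform_convergence {Z I : Type*} [Fintype Z] {n : ℕ} {w : Z → ℝ}
    (hw : ∀ z, 0 ≤ w z) (hw1 : ∑ z, w z = 1) {g : I → Z → ℝ} (hg : ∀ i z, |g i z| ≤ 1) {N : ℝ}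
    (hN : ∀ U : Finset Z, U.card ≤ 2 * n → ∃ R : Finset I, (R.card : ℝ) ≤ N ∧
      ∀ i, ∃ r ∈ R, ∀ z ∈ U, g i z = g r z)
    {δ : ℝ} (hδ : 0 ≤ δ) :
    ∑ s : Fin n → Z with ∃ i, n * δ < ∑ k, ((∑ z, w z * g i z) - g i (s k)), sampleWeight w s
      ≤ N * Real.exp (-(n * δ ^ 2 / 8)) := by
  have hN' : ∀ U : Finset Z, ∃ R : Finset I, U.card ≤ 2 * n → ((R.card : ℝ) ≤ N ∧
      ∀ i, ∃ r ∈ R, ∀ z ∈ U, g i z = g r z) := by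
    intro U
    by_cases hU : U.card ≤ 2 * n
    · obtain ⟨R, hR⟩ := hN U hU
      exact ⟨R, fun _ => hR⟩
    · exact ⟨∅, fun h => absurd h hU⟩
  choose R hR using hN'
  -- the optimal parameter of the exponential moment
  set a : ℝ := δ / 4 with ha
  have hstep : ∀ s : Fin n → Z, (∃ i, n * δ < ∑ k, ((∑ z, w z * g i z) - g i (s k))) →
      Real.exp (a * (n * δ)) ≤ ∑ s' : Fin n → Z, sampleWeight w s' *
        ∑ r ∈ R (samplePoints fun k => (s k, s' k)),
          ∏ k, Real.exp (a * (g r (s' k) - g r (s k))) := by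
    rintro s ⟨i, hi⟩
    calc Real.exp (a * (n * δ))
        ≤ Real.exp (a * ∑ k, ((∑ z, w z * g i z) - g i (s k))) := by gcongr
      _ = ∏ k, Real.exp (a * ((∑ z, w z * g i z) - g i (s k))) := by
          rw [Finset.mul_sum, Real.exp_sum]
      _ ≤ _ := prod_exp_le_sum_ghost hw hw1 (g i) a s
      _ ≤ _ := by
          refine Finset.sum_le_sum fun s' _ =>
            mul_le_mul_of_nonneg_left ?_ (sampleWeight_nonneg hw s')
          obtain ⟨r, hr, hir⟩ := (hR _ (card_samplePoints_le fun k => (s k, s' k))).2 i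
          have hmem : ∀ k, s k ∈ samplePoints (fun k => (s k, s' k)) ∧
              s' k ∈ samplePoints (fun k => (s k, s' k)) := fun k =>
            ⟨Finset.mem_biUnion.2 ⟨k, Finset.mem_univ _, by simp⟩,
              Finset.mem_biUnion.2 ⟨k, Finset.mem_univ _, by simp⟩⟩
          have : ∏ k, Real.exp (a * (g i (s' k) - g i (s k)))
              = ∏ k, Real.exp (a * (g r (s' k) - g r (s k))) :=
            Finset.prod_congr rfl fun k _ => by
              rw [hir _ (hmem k).1, hir _ (hmem k).2]
          rw [this]
          exact Finset.single_le_sum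
            (f := fun r => ∏ k, Real.exp (a * (g r (s' k) - g r (s k))))
            (fun r _ => by positivity) hr
  have hsum : (∑ s : Fin n → Z with ∃ i, n * δ < ∑ k, ((∑ z, w z * g i z) - g i (s k)),
      sampleWeight w s) * Real.exp (a * (n * δ)) ≤ N * Real.exp (n * (2 * a ^ 2)) := by
    refine le_trans ?_ (sum_doubled_sample_le hw hw1 hg R (fun U hU => (hR U hU).1) a)
    calc _ ≤ ∑ s : Fin n → Z with ∃ i, n * δ < ∑ k, ((∑ z, w z * g i z) - g i (s k)),
            sampleWeight w s * ∑ s' : Fin n → Z, sampleWeight w s' *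
            ∑ r ∈ R (samplePoints fun k => (s k, s' k)),
              ∏ k, Real.exp (a * (g r (s' k) - g r (s k))) := by
          rw [Finset.sum_mul]
          exact Finset.sum_le_sum fun s hs =>
            mul_le_mul_of_nonneg_left (hstep s (Finset.mem_filter.1 hs).2)
              (sampleWeight_nonneg hw s)
      _ ≤ ∑ s : Fin n → Z,
            sampleWeight w s * ∑ s' : Fin n → Z, sampleWeight w s' *
            ∑ r ∈ R (samplePoints fun k => (s k, s' k)),
              ∏ k, Real.exp (a * (g r (s' k) - g r (s k))) := by
          refine Finset.sum_le_sum_of_subset_of_nonneg (Finset.filter_subset _ _)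
            fun s _ _ => mul_nonneg (sampleWeight_nonneg hw s) (Finset.sum_nonneg fun s' _ =>
              mul_nonneg (sampleWeight_nonneg hw s') (Finset.sum_nonneg fun r _ => ?_))
          positivity
      _ = _ := by
          rw [← Equiv.sum_comp (Equiv.arrowProdEquivProdArrow (Fin n) (fun _ => Z)
              (fun _ => Z)).symm,
            Fintype.sum_prod_type]
          refine Finset.sum_congr rfl fun s _ => ?_
          rw [Finset.mul_sum]
          refine Finset.sum_congr rfl fun s' _ => ?_
          rw [← mul_assoc, sampleWeight, sampleWeight, ← Finset.prod_mul_distrib]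
          rfl
  have hexp : N * Real.exp (-(n * δ ^ 2 / 8)) * Real.exp (a * (n * δ))
      = N * Real.exp (n * (2 * a ^ 2)) := by
    rw [mul_assoc, ← Real.exp_add, ha]
    congr 2
    ring
  exact le_of_mul_le_mul_right (hsum.trans hexp.ge) (Real.exp_pos _)

end UniformConvergence

/-! ### Covers of families of small VC dimension -/

section Covers

/-- A set of `m` points has at most `θ ^ (-d) (1 + θ) ^ m` subsets with at most `d` elements:
each of them has weight at least `θ ^ d` in the binomial expansion of `(1 + θ) ^ m`. -/
theorem card_powerset_card_le {X : Type*} [DecidableEq X] (U : Finset X) (d : ℕ) {θ : ℝ}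
    (h0 : 0 < θ) (h1 : θ ≤ 1) :
    ((U.powerset.filter fun B => B.card ≤ d).card : ℝ) ≤ (θ⁻¹) ^ d * (1 + θ) ^ U.card := by
  have h2 : ((U.powerset.filter fun B => B.card ≤ d).card : ℝ) * θ ^ d ≤ (1 + θ) ^ U.card := by
    rw [add_comm, ← Finset.sum_pow_mul_eq_add_pow, ← nsmul_eq_mul]
    refine (Finset.card_nsmul_le_sum _ (fun B => θ ^ B.card * 1 ^ (U.card - B.card)) _
      fun B hB => ?_).trans
      (Finset.sum_le_sum_of_subset_of_nonneg (Finset.filter_subset _ _) fun B _ _ => by positivity)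
    rw [one_pow, mul_one]
    exact pow_le_pow_of_le_one h0.le h1 (Finset.mem_filter.1 hB).2
  rw [inv_pow, inv_mul_eq_div, le_div_iff₀ (by positivity)]
  exact h2

/-- On the points of `U`, each member of `C` agrees with one of few members of `C`
(a form of the Sauer–Shelah lemma). -/
theorem exists_cover {X : Type*} [Fintype X] (C : Finset (X → Bool)) (U : Finset X) {θ : ℝ}
    (h0 : 0 < θ) (h1 : θ ≤ 1) :
    ∃ R : Finset C, (R.card : ℝ) ≤ (θ⁻¹) ^ vcDimension C * (1 + θ) ^ U.card ∧
      ∀ c : C, ∃ r ∈ R, ∀ x ∈ U, c.1 x = r.1 x := by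
  classical
  set S : (X → Bool) → Finset X := fun c => Finset.univ.filter fun j => c j = true with hS
  set 𝒜 : Finset (Finset X) := C.attach.image fun c => U ∩ S c.1 with h𝒜
  have hsh : 𝒜.shatterer ⊆ U.powerset.filter fun B => B.card ≤ vcDimension C := by
    intro B hB
    rw [Finset.mem_shatterer] at hB
    obtain ⟨u, hu, hBu⟩ := hB.exists_superset
    obtain ⟨c, -, rfl⟩ := Finset.mem_image.1 hu
    have hBU : B ⊆ U := hBu.trans Finset.inter_subset_left
    refine Finset.mem_filter.2 ⟨Finset.mem_powerset.2 hBU, ?_⟩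
    have : (C.image S).Shatters B := by
      intro t ht
      obtain ⟨u, hu, htu⟩ := hB ht
      obtain ⟨c, -, rfl⟩ := Finset.mem_image.1 hu
      refine ⟨S c.1, Finset.mem_image_of_mem _ c.2, ?_⟩
      rw [← htu, ← Finset.inter_assoc, Finset.inter_eq_left.2 hBU]
    have hle := this.card_le_vcDim
    unfold vcDimension
    convert hle
  have hcard : (𝒜.card : ℝ) ≤ (θ⁻¹) ^ vcDimension C * (1 + θ) ^ U.card := by
    refine le_trans ?_ (card_powerset_card_le U (vcDimension C) h0 h1)
    exact_mod_cast (Finset.card_le_card_shatterer 𝒜).trans (Finset.card_le_card hsh)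
  have hpick : ∀ B ∈ 𝒜, ∃ c : C, U ∩ S c.1 = B := fun B hB => by
    obtain ⟨c, -, h⟩ := Finset.mem_image.1 hB
    exact ⟨c, h⟩
  choose pick hpick using hpick
  refine ⟨𝒜.attach.image fun B => pick B.1 B.2, ?_, fun c => ?_⟩
  · refine le_trans ?_ hcard
    exact_mod_cast Finset.card_image_le.trans (Finset.card_attach).le
  · have hc : U ∩ S c.1 ∈ 𝒜 := Finset.mem_image_of_mem (fun c : C => U ∩ S c.1)
      (Finset.mem_attach _ _)
    refine ⟨pick _ hc, Finset.mem_image.2 ⟨⟨_, hc⟩, Finset.mem_attach _ _, rfl⟩, fun x hx => ?_⟩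
    have := Finset.ext_iff.1 (hpick _ hc) x
    simp only [hS, Finset.mem_inter, hx, true_and, Finset.mem_filter, Finset.mem_univ] at this
    exact (Bool.eq_iff_iff.2 this).symm

/-- The same for selectors, which choose a member of `C` for each element of `K`. -/
theorem exists_cover_selectors {X K : Type*} [Fintype X] [Fintype K] (C : Finset (X → Bool))
    (U : Finset X) {θ : ℝ} (h0 : 0 < θ) (h1 : θ ≤ 1) :
    ∃ R : Finset (K → C),
      (R.card : ℝ) ≤ ((θ⁻¹) ^ vcDimension C * (1 + θ) ^ U.card) ^ Fintype.card K ∧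
      ∀ κ : K → C, ∃ r ∈ R, ∀ x ∈ U, ∀ k, (κ k).1 x = (r k).1 x := by
  classical
  obtain ⟨R, hR, hcov⟩ := exists_cover C U h0 h1
  refine ⟨Fintype.piFinset fun _ => R, ?_, fun κ => ?_⟩
  · rw [Fintype.card_piFinset, Finset.prod_const, Finset.card_univ, Nat.cast_pow]
    gcongr
  · choose r hr h using hcov
    exact ⟨fun k => r (κ k), Fintype.mem_piFinset.2 fun k => hr _, fun x hx k => h _ x hx⟩

end Covers

/-! ### Multiplicative weights -/

section Boosting

/-- The value at the outcome `o` of the test given by a set `A` of triples (cell, group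
membership, outcome), for an individual with a prediction in the cell `k`. The membership function
may depend on the cell; its value at the individual for the cell `k'` is `b k'`. -/
def testValue {K O : Type*} (b : K → Bool) (A : K × Bool × O → Bool) (k : K) (o : O) : ℝ :=
  if A (k, b k, o) then 1 else 0

theorem testValue_nonneg {K O : Type*} (b : K → Bool) (A : K × Bool × O → Bool) (k : K) (o : O) :
    0 ≤ testValue b A k o := by
  unfold testValue
  split <;> simp

theorem testValue_le_one {K O : Type*} (b : K → Bool) (A : K × Bool × O → Bool) (k : K) (o : O) :
    testValue b A k o ≤ 1 := by
  unfold testValue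
  split <;> simp

variable {O : Type*} [Fintype O]

theorem sum_mul_exp_pos (q : stdSimplex ℝ O) (f : O → ℝ) : 0 < ∑ o, q o * Real.exp (f o) := by
  obtain ⟨o, ho⟩ : ∃ o, q o ≠ 0 := by
    by_contra! h
    have := stdSimplex.sum_eq_one q
    simp [h] at this
  exact Finset.sum_pos' (fun o _ => mul_nonneg (stdSimplex.zero_le q o) (Real.exp_pos _).le)
    ⟨o, Finset.mem_univ _,
      mul_pos (lt_of_le_of_ne (stdSimplex.zero_le q o) ho.symm) (Real.exp_pos _)⟩

/-- The distribution with density proportional to `exp f` with respect to `q`. -/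
noncomputable def tilt (q : stdSimplex ℝ O) (f : O → ℝ) : stdSimplex ℝ O :=
  ⟨fun o => q o * Real.exp (f o) / ∑ o', q o' * Real.exp (f o'),
    fun o => div_nonneg (mul_nonneg (stdSimplex.zero_le q o) (Real.exp_pos _).le)
      (sum_mul_exp_pos q f).le,
    by rw [← Finset.sum_div, div_self (sum_mul_exp_pos q f).ne']⟩

theorem tilt_apply (q : stdSimplex ℝ O) (f : O → ℝ) (o : O) :
    tilt q f o = q o * Real.exp (f o) / ∑ o', q o' * Real.exp (f o') := rfl

theorem tilt_zero (q : stdSimplex ℝ O) : tilt q (fun _ => 0) = q := by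
  ext o
  change tilt q (fun _ => 0) o = q o
  simp [tilt_apply, stdSimplex.sum_eq_one]

theorem tilt_pos {q : stdSimplex ℝ O} (hq : ∀ o, 0 < q o) (f : O → ℝ) (o : O) :
    0 < tilt q f o := by
  rw [tilt_apply]
  exact div_pos (mul_pos (hq o) (Real.exp_pos _)) (sum_mul_exp_pos q f)

/-- A multiplicative update raises the log-likelihood of the outcome `o` by the step size times
the amount by which the value at `o` exceeds the predicted mean, up to a quadratic error. -/
theorem log_tilt_ge {q : stdSimplex ℝ O} (hq : ∀ o, 0 < q o) {f : O → ℝ} (hf0 : ∀ o, 0 ≤ f o)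
    (hf1 : ∀ o, f o ≤ 1) {η : ℝ} (h0 : 0 ≤ η) (h1 : η ≤ 1) (o : O) :
    Real.log (q o) + η * (f o - ∑ o', q o' * f o') - η ^ 2
      ≤ Real.log (tilt q (fun o => η * f o) o) := by
  rw [tilt_apply, Real.log_div (mul_pos (hq o) (Real.exp_pos _)).ne' (sum_mul_exp_pos q _).ne',
    Real.log_mul (hq o).ne' (Real.exp_pos _).ne', Real.log_exp]
  have h2 := Real.log_le_sub_one_of_pos (sum_mul_exp_pos q fun o => η * f o)
  have h3 : ∑ o', q o' * Real.exp (η * f o') ≤ ∑ o', (q o' * (1 + η ^ 2) + η * (q o' * f o')) := by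
    refine Finset.sum_le_sum fun o' _ => ?_
    have h4 : |η * f o'| ≤ 1 := by
      rw [abs_of_nonneg (mul_nonneg h0 (hf0 o'))]
      nlinarith [hf0 o', hf1 o']
    have h5 := (abs_le.1 (Real.abs_exp_sub_one_sub_id_le h4)).2
    have h6 : (η * f o') ^ 2 ≤ η ^ 2 := by
      rw [mul_pow]
      exact mul_le_of_le_one_right (sq_nonneg η) (pow_le_one₀ (hf0 o') (hf1 o'))
    have := mul_le_mul_of_nonneg_left
      (show Real.exp (η * f o') ≤ 1 + η ^ 2 + η * f o' by linarith) (stdSimplex.zero_le q o')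
    linarith
  rw [Finset.sum_add_distrib, ← Finset.sum_mul, ← Finset.mul_sum, stdSimplex.sum_eq_one] at h3
  linarith

/-- The mean of a function of the outcome under a predicted distribution, subtracted from the
function's value. Its average over a law is the advantage of a test in telling the actual from
the modeled outcome. -/
def excess (p : stdSimplex ℝ O) (f : O → ℝ) (o : O) : ℝ := f o - ∑ o', p o' * f o'

theorem sum_mul_mem_Icc (p : stdSimplex ℝ O) {f : O → ℝ} (hf0 : ∀ o, 0 ≤ f o)
    (hf1 : ∀ o, f o ≤ 1) : ∑ o, p o * f o ∈ Set.Icc (0 : ℝ) 1 := by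
  refine ⟨Finset.sum_nonneg fun o _ => mul_nonneg (stdSimplex.zero_le p o) (hf0 o), ?_⟩
  rw [← stdSimplex.sum_eq_one p]
  exact Finset.sum_le_sum fun o _ => mul_le_of_le_one_right (stdSimplex.zero_le p o) (hf1 o)

theorem abs_excess_le_one (p : stdSimplex ℝ O) {f : O → ℝ} (hf0 : ∀ o, 0 ≤ f o)
    (hf1 : ∀ o, f o ≤ 1) (o : O) : |excess p f o| ≤ 1 := by
  have h := sum_mul_mem_Icc p hf0 hf1
  unfold excess
  rw [abs_le]
  constructor <;> linarith [h.1, h.2, hf0 o, hf1 o]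

theorem excess_le_excess_add (p q : stdSimplex ℝ O) {f : O → ℝ} (hf0 : ∀ o, 0 ≤ f o)
    (hf1 : ∀ o, f o ≤ 1) (o : O) : excess p f o ≤ excess q f o + ∑ o', |p o' - q o'| := by
  have : ∑ o', q o' * f o' ≤ ∑ o', (p o' * f o' + |p o' - q o'|) := by
    refine Finset.sum_le_sum fun o' _ => ?_
    have h1 : (q o' - p o') * f o' ≤ |p o' - q o'| * 1 := by
      rw [abs_sub_comm]
      exact mul_le_mul (le_abs_self _) (hf1 o') (hf0 o') (abs_nonneg _)
    linarith
  rw [Finset.sum_add_distrib] at this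
  unfold excess
  linarith

variable {K : Type*} [Nonempty O]

/-- The distribution that results from the uniform one by successive multiplicative updates, the
last of them first in the list. Each test is evaluated at the cell of the current distribution. -/
noncomputable def boosted (η : ℝ) (cell : stdSimplex ℝ O → K) :
    List ((K → Bool) × (K × Bool × O → Bool)) → stdSimplex ℝ O
  | [] => stdSimplex.barycenter
  | τ :: L => tilt (boosted η cell L)
      fun o => η * testValue τ.1 τ.2 (cell (boosted η cell L)) o

theorem boosted_pos (η : ℝ) (cell : stdSimplex ℝ O → K)
    (L : List ((K → Bool) × (K × Bool × O → Bool))) (o : O) : 0 < boosted η cell L o := by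
  induction L generalizing o with
  | nil =>
    change (0 : ℝ) < (Fintype.card O : ℝ)⁻¹
    have := Fintype.card_pos (α := O)
    positivity
  | cons τ L ih => exact tilt_pos ih _ o

end Boosting

section Learner

/-- The updates that the tests in `L` prescribe for the individual `x`. -/
def updatesAt {X O K H : Type*} (h : H → X → K → Bool) {t : ℕ}
    (L : Fin t → H × (K × Bool × O → Bool)) (x : X) :
    List ((K → Bool) × (K × Bool × O → Bool)) :=
  List.ofFn fun j => (h (L j).1 x, (L j).2)

theorem updatesAt_cons {X O K H : Type*} (h : H → X → K → Bool) {t : ℕ}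
    (τ : H × (K × Bool × O → Bool))
    (L : Fin t → H × (K × Bool × O → Bool)) (x : X) :
    updatesAt h (Fin.cons τ L : Fin (t + 1) → H × (K × Bool × O → Bool)) x
      = (h τ.1 x, τ.2) :: updatesAt h L x := by
  simp [updatesAt, List.ofFn_succ]

variable {X O K H : Type*} [Fintype O] [Nonempty O]

/-- The advantage of the test `τ` at the individual-outcome pair `z`, for the predictor that the
updates `L` produce. -/
noncomputable def advantage (η : ℝ) (cell : stdSimplex ℝ O → K) (rep : K → stdSimplex ℝ O)
    (h : H → X → K → Bool) {t : ℕ} (L : Fin t → H × (K × Bool × O → Bool))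
    (τ : H × (K × Bool × O → Bool)) (z : X × O) : ℝ :=
  excess (rep (cell (boosted η cell (updatesAt h L z.1))))
    (testValue (h τ.1 z.1) τ.2 (cell (boosted η cell (updatesAt h L z.1)))) z.2

/-- As long as some test has advantage more than `ε / 2` on the sample, one more update raises the
log-likelihood by at least `ε ^ 2 / 64` per point. The predictor tested is the rounded one, the
one updated is not rounded; rounding costs at most `ε / 4` of the advantage. -/
theorem exists_updates_step [Nonempty H] {cell : stdSimplex ℝ O → K} {rep : K → stdSimplex ℝ O}
    {ε : ℝ} (hε0 : 0 < ε) (hε1 : ε ≤ 1)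
    (hrep : ∀ q, ∑ o, |rep (cell q) o - q o| ≤ ε / 4)
    (h : H → X → K → Bool) {n : ℕ} (s : Fin n → X × O) (t : ℕ) :
    ∃ L : Fin t → H × (K × Bool × O → Bool),
      (∀ τ, ∑ i, advantage (ε / 8) cell rep h L τ (s i) ≤ n * (ε / 2)) ∨
      n * (t * (ε ^ 2 / 64) - Real.log (Fintype.card O))
        ≤ ∑ i, Real.log (boosted (ε / 8) cell (updatesAt h L (s i).1) (s i).2) := by
  induction t with
  | zero =>
    refine ⟨Fin.elim0, Or.inr ?_⟩
    have : ∀ z : X × O, boosted (ε / 8) cell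
        (updatesAt h (Fin.elim0 : Fin 0 → H × (K × Bool × O → Bool)) z.1) z.2
        = (Fintype.card O : ℝ)⁻¹ := fun z => rfl
    simp [this]
  | succ t ih =>
    obtain ⟨L, hL⟩ := ih
    by_cases hgood : ∀ τ, ∑ i, advantage (ε / 8) cell rep h L τ (s i) ≤ n * (ε / 2)
    · -- updating with the empty test changes nothing
      obtain ⟨h0⟩ := ‹Nonempty H›
      refine ⟨Fin.cons (h0, fun _ => false) L, Or.inl ?_⟩
      have : ∀ x, boosted (ε / 8) cell (updatesAt h (Fin.cons (h0, fun _ => false) L :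
          Fin (t + 1) → H × (K × Bool × O → Bool)) x)
          = boosted (ε / 8) cell (updatesAt h L x) := by
        intro x
        rw [updatesAt_cons, boosted]
        simp [testValue, tilt_zero]
      simpa only [advantage, this] using hgood
    · have hL := hL.resolve_left hgood
      push Not at hgood
      obtain ⟨τ, hτ⟩ := hgood
      refine ⟨Fin.cons τ L, Or.inr ?_⟩
      have hstep : ∀ z : X × O, Real.log (boosted (ε / 8) cell (updatesAt h L z.1) z.2)
          + (ε / 8) * (advantage (ε / 8) cell rep h L τ z - ε / 4) - (ε / 8) ^ 2
          ≤ Real.log (boosted (ε / 8) cell (updatesAt h (Fin.cons τ L :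
            Fin (t + 1) → H × (K × Bool × O → Bool)) z.1) z.2) := by
        intro z
        rw [updatesAt_cons, boosted]
        refine le_trans ?_ (log_tilt_ge (boosted_pos _ _ _) (testValue_nonneg _ _ _)
          (testValue_le_one _ _ _) (by positivity) (by linarith) z.2)
        have h1 := excess_le_excess_add (rep (cell (boosted (ε / 8) cell (updatesAt h L z.1))))
          (boosted (ε / 8) cell (updatesAt h L z.1))
          (testValue_nonneg (h τ.1 z.1) τ.2 (cell (boosted (ε / 8) cell (updatesAt h L z.1))))
          (testValue_le_one (h τ.1 z.1) τ.2 (cell (boosted (ε / 8) cell (updatesAt h L z.1)))) z.2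
        have h2 := hrep (boosted (ε / 8) cell (updatesAt h L z.1))
        have h3 : advantage (ε / 8) cell rep h L τ z - ε / 4
            ≤ excess (boosted (ε / 8) cell (updatesAt h L z.1))
              (testValue (h τ.1 z.1) τ.2 (cell (boosted (ε / 8) cell (updatesAt h L z.1))))
              z.2 := by
          unfold advantage
          linarith
        have h4 := mul_le_mul_of_nonneg_left h3 (show 0 ≤ ε / 8 by positivity)
        unfold excess at h4
        linarith
      have hsum := Finset.sum_le_sum fun i (_ : i ∈ Finset.univ) => hstep (s i)
      refine le_trans ?_ hsum
      simp only [Finset.sum_sub_distrib, Finset.sum_add_distrib, ← Finset.mul_sum,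
        Finset.sum_const, Finset.card_univ, Fintype.card_fin, nsmul_eq_mul]
      push_cast
      nlinarith [mul_le_mul_of_nonneg_left hτ.le (show 0 ≤ ε / 8 by positivity)]

/-- **Boosting.** Since the log-likelihood is never positive, `T` updates suffice to make the
advantage of each test on a given sample at most `ε / 2`. -/
theorem exists_updates [Nonempty H] {cell : stdSimplex ℝ O → K} {rep : K → stdSimplex ℝ O}
    {ε : ℝ} (hε0 : 0 < ε) (hε1 : ε ≤ 1)
    (hrep : ∀ q, ∑ o, |rep (cell q) o - q o| ≤ ε / 4)
    (h : H → X → K → Bool) {n : ℕ} (hn : 0 < n) (s : Fin n → X × O) {T : ℕ}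
    (hT : 64 * Real.log (Fintype.card O) / ε ^ 2 < T) :
    ∃ L : Fin T → H × (K × Bool × O → Bool),
      ∀ τ, ∑ i, advantage (ε / 8) cell rep h L τ (s i) ≤ n * (ε / 2) := by
  obtain ⟨L, hL | hL⟩ := exists_updates_step hε0 hε1 hrep h s T
  · exact ⟨L, hL⟩
  · exfalso
    have h1 : ∑ i, Real.log (boosted (ε / 8) cell (updatesAt h L (s i).1) (s i).2) ≤ 0 :=
      Finset.sum_nonpos fun i _ => Real.log_nonpos (stdSimplex.zero_le _ _) (stdSimplex.le_one _ _)
    rw [div_lt_iff₀ (by positivity)] at hT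
    have h2 : (0 : ℝ) < n * (T * (ε ^ 2 / 64) - Real.log (Fintype.card O)) :=
      mul_pos (by exact_mod_cast hn) (by linarith)
    linarith

end Learner

/-! ### Learning from a sample -/

section Sample

open Classical in
/-- The learner boosts on the sample. Its predictor is described by `T` tests, so that, with the
test that challenges it, it shows few behaviours on any set of points, and what holds on the
sample holds for the law up to `ε / 2`. -/
theorem exists_learner {X O K H : Type*} [Fintype X] [Fintype O] [Nonempty O] [Fintype K]
    [Nonempty H] {cell : stdSimplex ℝ O → K} {rep : K → stdSimplex ℝ O} {ε : ℝ} (hε0 : 0 < ε)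
    (hε1 : ε ≤ 1) (hrep : ∀ q, ∑ o, |rep (cell q) o - q o| ≤ ε / 4) (h : H → X → K → Bool)
    {n : ℕ} (hn : 0 < n) {T : ℕ} (hT : 64 * Real.log (Fintype.card O) / ε ^ 2 < T) {N : ℝ}
    (hN : ∀ U : Finset X, U.card ≤ 2 * n → ∃ R : Finset H, (R.card : ℝ) ≤ N ∧
      ∀ a, ∃ r ∈ R, ∀ x ∈ U, ∀ k, h a x k = h r x k)
    (hprob : (N * 2 ^ Fintype.card (K × Bool × O)) ^ (T + 1) * Real.exp (-(n * ε ^ 2 / 32))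
      ≤ 1 / 10) :
    ∃ k : (Fin n → X × O) → X → K, ∀ w : X × O → ℝ, (∀ z, 0 ≤ w z) → ∑ z, w z = 1 →
      ∑ s : Fin n → X × O with ∃ a A, ε < ∑ z, w z * excess (rep (k s z.1))
        (testValue (h a z.1) A (k s z.1)) z.2, sampleWeight w s ≤ 1 / 10 := by
  -- `L s` are the updates that boosting makes on the sample `s`
  choose L hL using fun s : Fin n → X × O => exists_updates hε0 hε1 hrep h hn s hT
  refine ⟨fun s x => cell (boosted (ε / 8) cell (updatesAt h (L s) x)), fun w hw hw1 => ?_⟩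
  set g : (Fin T → H × (K × Bool × O → Bool)) × (H × (K × Bool × O → Bool)) → X × O → ℝ :=
    fun i z => advantage (ε / 8) cell rep h i.1 i.2 z with hg
  have hg1 : ∀ i z, |g i z| ≤ 1 := fun i z =>
    abs_excess_le_one _ (testValue_nonneg _ _ _) (testValue_le_one _ _ _) _
  have hcover : ∀ U : Finset (X × O), U.card ≤ 2 * n →
      ∃ R : Finset ((Fin T → H × (K × Bool × O → Bool)) × (H × (K × Bool × O → Bool))),
        (R.card : ℝ) ≤ (N * 2 ^ Fintype.card (K × Bool × O)) ^ (T + 1) ∧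
        ∀ i, ∃ r ∈ R, ∀ z ∈ U, g i z = g r z := by
    intro U hU
    obtain ⟨R, hRN, hR⟩ := hN (U.image Prod.fst) (Finset.card_image_le.trans hU)
    choose r hrR hr using hR
    refine ⟨(Fintype.piFinset fun _ => R ×ˢ Finset.univ) ×ˢ (R ×ˢ Finset.univ), ?_, fun i => ?_⟩
    · have hN0 : (0 : ℝ) ≤ R.card := by positivity
      rw [Finset.card_product, Fintype.card_piFinset, Finset.prod_const, Finset.card_univ,
        Fintype.card_fin, Finset.card_product, ← pow_succ, Finset.card_univ, Fintype.card_fun,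
        Fintype.card_bool]
      push_cast
      gcongr
    · refine ⟨(fun j => (r (i.1 j).1, (i.1 j).2), (r i.2.1, i.2.2)), ?_, fun z hz => ?_⟩
      · simp [Fintype.mem_piFinset, hrR]
      · have hx : ∀ a, h a z.1 = h (r a) z.1 := fun a =>
          funext fun k => hr a z.1 (Finset.mem_image_of_mem _ hz) k
        simp only [hg, advantage, updatesAt, ← hx]
  refine le_trans ?_ ((uniform_convergence hw hw1 hg1 hcover
    (show 0 ≤ ε / 2 by positivity)).trans (le_trans (le_of_eq ?_) hprob))
  · refine Finset.sum_le_sum_of_subset_of_nonneg (fun s hs => ?_) fun s _ _ =>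
      sampleWeight_nonneg hw s
    obtain ⟨a, A, hA⟩ := (Finset.mem_filter.1 hs).2
    refine Finset.mem_filter.2 ⟨Finset.mem_univ _, (L s, (a, A)), ?_⟩
    rw [Finset.sum_sub_distrib, Finset.sum_const, Finset.card_univ, Fintype.card_fin, nsmul_eq_mul]
    have h1 := hL s (a, A)
    have h2 : (n : ℝ) * ε < n * ∑ z, w z * g (L s, (a, A)) z :=
      mul_lt_mul_of_pos_left hA (by exact_mod_cast hn)
    simp only [hg] at h2 ⊢
    linarith
  · ring_nf

/-- Rounding down the probabilities to multiples of `1 / m` divides the simplex into cells of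
diameter at most `ℓ / m`. -/
theorem exists_cells {O : Type*} [Fintype O] [Nonempty O] {m : ℕ} (hm : 0 < m) :
    ∃ (cell : stdSimplex ℝ O → O → Fin (m + 1)) (rep : (O → Fin (m + 1)) → stdSimplex ℝ O),
      ∀ q, ∑ o, |rep (cell q) o - q o| ≤ Fintype.card O / m := by
  have hm' : (0 : ℝ) < m := by exact_mod_cast hm
  have hlt : ∀ (q : stdSimplex ℝ O) (o : O), ⌊m * q o⌋₊ < m + 1 := fun q o => by
    refine Nat.lt_succ_of_le (Nat.floor_le_of_le ?_)
    exact mul_le_of_le_one_right hm'.le (stdSimplex.le_one q o)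
  set cell : stdSimplex ℝ O → O → Fin (m + 1) := fun q o => ⟨⌊m * q o⌋₊, hlt q o⟩ with hcell
  refine ⟨cell, Function.invFun cell, fun q => ?_⟩
  have hq : cell (Function.invFun cell (cell q)) = cell q := Function.invFun_eq ⟨q, rfl⟩
  set q' := Function.invFun cell (cell q)
  have hdist : ∀ o, |q' o - q o| ≤ 1 / m := fun o => by
    have h1 : ⌊m * q' o⌋₊ = ⌊m * q o⌋₊ := congrArg Fin.val (congrFun hq o)
    have h2 := Nat.floor_le (mul_nonneg hm'.le (stdSimplex.zero_le q o))
    have h3 := Nat.floor_le (mul_nonneg hm'.le (stdSimplex.zero_le q' o))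
    have h4 := Nat.lt_floor_add_one (m * q o)
    have h5 := Nat.lt_floor_add_one (m * q' o)
    rw [h1] at h3 h5
    rw [le_div_iff₀ hm', ← abs_of_pos hm', ← abs_mul, abs_le]
    constructor <;> nlinarith
  calc _ ≤ ∑ _o : O, (1 : ℝ) / m := Finset.sum_le_sum fun o _ => hdist o
    _ = _ := by simp [div_eq_mul_inv]

end Sample

/-! ### Laws on a finite set -/

section Laws

theorem measureReal_eq_sum {Z : Type*} [Fintype Z] [MeasurableSpace Z]
    [MeasurableSingletonClass Z] (μ : Measure Z) [IsFiniteMeasure μ] (B : Set Z)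
    [DecidablePred (· ∈ B)] : μ.real B = ∑ z, μ.real {z} * if z ∈ B then 1 else 0 := by
  simp only [mul_ite, mul_one, mul_zero]
  rw [← Finset.sum_filter, sum_measureReal_singleton]
  simp

open Classical in
theorem pi_real_eq_sum {Z : Type*} [Fintype Z] [MeasurableSpace Z]
    [MeasurableSingletonClass Z] (D : Measure Z) [IsProbabilityMeasure D] (n : ℕ)
    (P : (Fin n → Z) → Prop) :
    (Measure.pi fun _ => D).real {s | P s}
      = ∑ s : Fin n → Z with P s, sampleWeight (fun z => D.real {z}) s := by
  have h1 : ∀ s : Fin n → Z, sampleWeight (fun z => D.real {z}) s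
      = (Measure.pi fun _ => D).real {s} := fun s => by
    rw [Measure.real, Measure.pi_singleton, ENNReal.toReal_prod]
    rfl
  simp only [h1]
  rw [sum_measureReal_singleton]
  simp

variable {X O : Type*} [Fintype X] [Fintype O] [MeasurableSpace X] [MeasurableSpace O]

instance isFiniteMeasure_modeledLaw (D : Measure (X × O)) [IsProbabilityMeasure D]
    (p : Predictor X O) : IsFiniteMeasure (modeledLaw D p) := by
  refine ⟨?_⟩
  simp only [modeledLaw, Measure.coe_finsetSum, Finset.sum_apply, Measure.smul_apply,
    measure_univ, smul_eq_mul, mul_one]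
  exact ENNReal.sum_lt_top.2 fun j _ => ENNReal.sum_lt_top.2 fun o _ =>
    ENNReal.mul_lt_top (measure_lt_top _ _) ENNReal.ofReal_lt_top

variable [MeasurableSingletonClass X] [MeasurableSingletonClass O]

open Classical in
theorem modeledLaw_real (D : Measure (X × O)) [IsProbabilityMeasure D] (p : Predictor X O)
    (B : Set (X × O)) :
    (modeledLaw D p).real B
      = ∑ j, D.real (Prod.fst ⁻¹' {j}) * ∑ o, p j o * if (j, o) ∈ B then 1 else 0 := by
  rw [Measure.real]
  simp only [modeledLaw, Measure.coe_finsetSum, Finset.sum_apply, Measure.smul_apply, smul_eq_mul,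
    Measure.dirac_apply]
  rw [ENNReal.toReal_sum fun j _ => (ENNReal.sum_lt_top.2 fun o _ => ?_).ne]
  · refine Finset.sum_congr rfl fun j _ => ?_
    rw [ENNReal.toReal_sum, Finset.mul_sum]
    · refine Finset.sum_congr rfl fun o _ => ?_
      rw [ENNReal.toReal_mul, ENNReal.toReal_mul, ENNReal.toReal_ofReal (stdSimplex.zero_le _ _),
        mul_assoc, Measure.real]
      congr 2
      by_cases h : (j, o) ∈ B <;> simp [h]
    · intro o _
      refine (ENNReal.mul_lt_top (ENNReal.mul_lt_top (measure_lt_top _ _)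
        ENNReal.ofReal_lt_top) ?_).ne
      by_cases h : (j, o) ∈ B <;> simp [h]
  · refine ENNReal.mul_lt_top (ENNReal.mul_lt_top (measure_lt_top _ _)
      ENNReal.ofReal_lt_top) ?_
    by_cases h : (j, o) ∈ B <;> simp [h]

open Classical in
/-- The advantage of an event in telling the actual from the modeled outcome. -/
theorem real_sub_modeledLaw_real (D : Measure (X × O)) [IsProbabilityMeasure D]
    (p : Predictor X O) (B : Set (X × O)) :
    D.real B - (modeledLaw D p).real B
      = ∑ z, D.real {z} * excess (p z.1) (fun o => if (z.1, o) ∈ B then 1 else 0) z.2 := by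
  have h1 : ∀ j, D.real (Prod.fst ⁻¹' {j}) = ∑ o, D.real {(j, o)} := fun j => by
    rw [measureReal_eq_sum, Fintype.sum_prod_type,
      Finset.sum_eq_single j (fun j' _ hj => by simp [hj]) (by simp)]
    simp
  rw [measureReal_eq_sum, modeledLaw_real]
  simp only [excess, mul_sub, Finset.sum_sub_distrib]
  congr 1
  rw [Fintype.sum_prod_type]
  exact Finset.sum_congr rfl fun j _ => by rw [h1, Finset.sum_mul]

/-- The modeled and the actual law give the same probability to an event that is determined by
the individual. -/
theorem modeledLaw_real_fst (D : Measure (X × O)) [IsProbabilityMeasure D]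
    (p : Predictor X O) (S : Set X) :
    (modeledLaw D p).real (Prod.fst ⁻¹' S) = D.real (Prod.fst ⁻¹' S) := by
  classical
  have := real_sub_modeledLaw_real D p (Prod.fst ⁻¹' S)
  rw [Finset.sum_eq_zero] at this
  · linarith
  · rintro z -
    by_cases hz : z.1 ∈ S <;> simp [excess, hz, stdSimplex.sum_eq_one]

/-- The advantage of an event within a set of individuals, in absolute value, is the advantage
of the event or that of its complement. -/
theorem abs_modeledLaw_sub_eq (D : Measure (X × O)) [IsProbabilityMeasure D]
    (p : Predictor X O) (S : Set X) (B : Set (X × O)) :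
    |(modeledLaw D p).real (Prod.fst ⁻¹' S ∩ B) - D.real (Prod.fst ⁻¹' S ∩ B)|
        = D.real (Prod.fst ⁻¹' S ∩ B) - (modeledLaw D p).real (Prod.fst ⁻¹' S ∩ B) ∨
    |(modeledLaw D p).real (Prod.fst ⁻¹' S ∩ B) - D.real (Prod.fst ⁻¹' S ∩ B)|
        = D.real (Prod.fst ⁻¹' S ∩ Bᶜ) - (modeledLaw D p).real (Prod.fst ⁻¹' S ∩ Bᶜ) := by
  have h1 := measureReal_inter_add_sdiff (μ := D) (s := Prod.fst ⁻¹' S)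
    (Set.toFinite B).measurableSet
  have h2 := measureReal_inter_add_sdiff (μ := modeledLaw D p) (s := Prod.fst ⁻¹' S)
    (Set.toFinite B).measurableSet
  rw [modeledLaw_real_fst] at h2
  rw [Set.sdiff_eq] at h1 h2
  rcases abs_choice ((modeledLaw D p).real (Prod.fst ⁻¹' S ∩ B) - D.real (Prod.fst ⁻¹' S ∩ B))
    with h | h
  · right
    rw [h]
    linarith
  · left
    rw [h]
    ring

/-- Multi-calibration follows from bounds on the advantages, without absolute values. -/
theorem multiCalibrated_of_le {C : Finset (X → Bool)} {ε : ℝ} (hε : 0 ≤ ε) (D : Measure (X × O))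
    [IsProbabilityMeasure D] (p : Predictor X O)
    (h : ∀ c ∈ C, ∀ A : Set (Bool × O × stdSimplex ℝ O),
      D.real {z | (c z.1, z.2, p z.1) ∈ A} - (modeledLaw D p).real {z | (c z.1, z.2, p z.1) ∈ A}
        ≤ ε) :
    MultiCalibrated C ε D p := by
  intro c hc
  refine Real.iSup_le (fun A => ?_) hε
  have := abs_modeledLaw_sub_eq D p Set.univ ((fun z : X × O => (c z.1, z.2, p z.1)) ⁻¹' A)
  rw [Set.preimage_univ, Set.univ_inter, Set.univ_inter] at this
  rcases this with h1 | h1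
  · rw [h1]
    exact h c hc A
  · rw [h1]
    exact h c hc Aᶜ

/-- The maximal conditional distance at a prediction is attained by some member of `C` and some
event; multiplied by the probability of the prediction it is an advantage. Both sides vanish if
that probability does, whatever the conditional laws are. -/
theorem exists_mul_condStatDist_le {C : Finset (X → Bool)} [Nonempty C] (D : Measure (X × O))
    [IsProbabilityMeasure D] (p : Predictor X O) (v : stdSimplex ℝ O) :
    ∃ (c : C) (A : Set (Bool × O)),
      D.real (levelSet p v) * (⨆ c : C, condStatDist D p (c : X → Bool) v)
        ≤ D.real (levelSet p v ∩ {z | (c.1 z.1, z.2) ∈ A})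
          - (modeledLaw D p).real (levelSet p v ∩ {z | (c.1 z.1, z.2) ∈ A}) := by
  have hlev : levelSet p v = Prod.fst ⁻¹' {x | p x = v} := rfl
  obtain ⟨c, hc⟩ := exists_eq_ciSup_of_finite (f := fun c : C => condStatDist D p (c : X → Bool) v)
  by_cases h0 : D.real (levelSet p v) = 0
  · exact ⟨c, ∅, by simp [h0]⟩
  obtain ⟨A, hA⟩ := exists_eq_ciSup_of_finite (f := fun A : Set (Bool × O) =>
    |(ProbabilityTheory.cond (modeledLaw D p) (levelSet p v)).real
        ((fun z : X × O => (c.1 z.1, z.2)) ⁻¹' A)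
      - (ProbabilityTheory.cond D (levelSet p v)).real
        ((fun z : X × O => (c.1 z.1, z.2)) ⁻¹' A)|)
  have hval : D.real (levelSet p v) * (⨆ c : C, condStatDist D p (c : X → Bool) v)
      = |(modeledLaw D p).real (levelSet p v ∩ {z | (c.1 z.1, z.2) ∈ A})
        - D.real (levelSet p v ∩ {z | (c.1 z.1, z.2) ∈ A})| := by
    rw [← hc]
    unfold condStatDist statDist
    rw [← hA]
    simp only [Measure.real, ProbabilityTheory.cond_apply (Set.toFinite _).measurableSet,
      ENNReal.toReal_mul, ENNReal.toReal_inv]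
    simp only [← Measure.real_def]
    have : (modeledLaw D p).real (levelSet p v) = D.real (levelSet p v) := by
      rw [hlev, modeledLaw_real_fst]
    rw [this, ← mul_sub, abs_mul, abs_of_nonneg (inv_nonneg.2 measureReal_nonneg), ← mul_assoc,
      mul_inv_cancel₀ h0, one_mul]
    rfl
  rw [hval, hlev]
  rcases abs_modeledLaw_sub_eq D p {x | p x = v} {z | (c.1 z.1, z.2) ∈ A} with h1 | h1
  · exact ⟨c, A, h1.le⟩
  · exact ⟨c, Aᶜ, h1.le⟩

/-- Strict multi-calibration follows from bounds on the advantages of those events that test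
for membership in a set of `C` that depends on the prediction. -/
theorem strictlyMultiCalibrated_of_le {C : Finset (X → Bool)} {ε : ℝ} (hε : 0 ≤ ε)
    (D : Measure (X × O)) [IsProbabilityMeasure D] (p : Predictor X O)
    (h : ∀ (κ : stdSimplex ℝ O → C) (A : Set (Bool × O × stdSimplex ℝ O)),
      D.real {z | ((κ (p z.1)).1 z.1, z.2, p z.1) ∈ A}
        - (modeledLaw D p).real {z | ((κ (p z.1)).1 z.1, z.2, p z.1) ∈ A} ≤ ε) :
    StrictlyMultiCalibrated C ε D p := by
  classical
  unfold StrictlyMultiCalibrated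
  rcases isEmpty_or_nonempty C with hC | hC
  · simpa using hε
  choose κ A hκ using exists_mul_condStatDist_le (C := C) D p
  refine le_trans ?_ (h κ {y | (y.1, y.2.1) ∈ A y.2.2})
  set F : stdSimplex ℝ O → ℝ := fun v => ⨆ c : C, condStatDist D p (c : X → Bool) v with hF
  set V : Finset (stdSimplex ℝ O) := Finset.univ.image p
  have hsum : ∀ μ : Measure (X × O), IsFiniteMeasure μ →
      μ.real {z | ((κ (p z.1)).1 z.1, z.2) ∈ A (p z.1)}
        = ∑ v ∈ V, μ.real (levelSet p v ∩ {z | ((κ v).1 z.1, z.2) ∈ A v}) := by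
    intro μ _
    rw [← measureReal_biUnion_finset]
    · congr 1
      ext z
      simp only [V, levelSet, Set.mem_ofPred_eq, Set.mem_iUnion, Finset.mem_image,
        Finset.mem_univ, true_and, Set.mem_inter_iff, exists_prop, exists_exists_eq_and]
      refine ⟨fun h => ⟨z.1, rfl, h⟩, ?_⟩
      rintro ⟨x, hx, h⟩
      rwa [hx]
    · intro v _ v' _ hv
      refine Set.disjoint_left.2 fun z hz hz' => hv ?_
      exact (show p z.1 = v from hz.1).symm.trans hz'.1
    · exact fun v _ => (Set.toFinite _).measurableSet
  calc ∫ z, F (p z.1) ∂D = ∑ z, D.real {z} * F (p z.1) := by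
        rw [integral_fintype Integrable.of_finite]
        rfl
    _ = ∑ v ∈ V, D.real (levelSet p v) * F v := by
        rw [← Finset.sum_fiberwise_of_maps_to (s := Finset.univ) (t := V)
          (g := fun z : X × O => p z.1) fun z _ => Finset.mem_image_of_mem _ (Finset.mem_univ _)]
        refine Finset.sum_congr rfl fun v _ => ?_
        rw [measureReal_eq_sum, Finset.sum_mul, Finset.sum_filter]
        refine Finset.sum_congr rfl fun z _ => ?_
        by_cases hz : p z.1 = v <;> simp [levelSet, hz]
    _ ≤ _ := by
        refine (Finset.sum_le_sum fun v _ => hκ v).trans (le_of_eq ?_)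
        rw [Finset.sum_sub_distrib, ← hsum D inferInstance, ← hsum (modeledLaw D p) inferInstance]
        rfl

end Laws

/-! ### Learners for laws -/

section Algorithms

variable {X O : Type*} [Fintype X] [Fintype O] [MeasurableSpace X] [MeasurableSpace O]
  [MeasurableSingletonClass X] [MeasurableSingletonClass O]

/-- Bounds on the advantages of tests, in terms of cells, give bounds on the advantages of events
that involve the prediction itself. -/
theorem real_sub_modeledLaw_real_le {K : Type*} {ε : ℝ} (D : Measure (X × O))
    [IsProbabilityMeasure D] (rep : K → stdSimplex ℝ O) (k : X → K) (b : X → K → Bool)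
    (h : ∀ A, ∑ z, D.real {z} * excess (rep (k z.1)) (testValue (b z.1) A (k z.1)) z.2 ≤ ε)
    (A : Set (Bool × O × stdSimplex ℝ O)) :
    D.real {z | (b z.1 (k z.1), z.2, rep (k z.1)) ∈ A}
      - (modeledLaw D fun x => rep (k x)).real {z | (b z.1 (k z.1), z.2, rep (k z.1)) ∈ A}
      ≤ ε := by
  classical
  rw [real_sub_modeledLaw_real]
  refine le_trans (le_of_eq ?_) (h fun y => decide ((y.2.1, y.2.2, rep y.1) ∈ A))
  simp [excess, testValue]

/-- The learner succeeds with probability at least `9 / 10` for any law. -/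
theorem exists_algorithm [Nonempty O] {K H : Type*} [Fintype K]
    [Nonempty H] {cell : stdSimplex ℝ O → K} {rep : K → stdSimplex ℝ O} {ε : ℝ} (hε0 : 0 < ε)
    (hε1 : ε ≤ 1) (hrep : ∀ q, ∑ o, |rep (cell q) o - q o| ≤ ε / 4) (h : H → X → K → Bool)
    {n : ℕ} (hn : 0 < n) {T : ℕ} (hT : 64 * Real.log (Fintype.card O) / ε ^ 2 < T) {N : ℝ}
    (hN : ∀ U : Finset X, U.card ≤ 2 * n → ∃ R : Finset H, (R.card : ℝ) ≤ N ∧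
      ∀ a, ∃ r ∈ R, ∀ x ∈ U, ∀ k, h a x k = h r x k)
    (hprob : (N * 2 ^ Fintype.card (K × Bool × O)) ^ (T + 1) * Real.exp (-(n * ε ^ 2 / 32))
      ≤ 1 / 10) :
    ∃ k : (Fin n → X × O) → X → K, ∀ (D : Measure (X × O)) [IsProbabilityMeasure D],
      9 / 10 ≤ (Measure.pi fun _ => D).real {s | ∀ a A, ∑ z, D.real {z} * excess (rep (k s z.1))
        (testValue (h a z.1) A (k s z.1)) z.2 ≤ ε} := by
  classical
  obtain ⟨k, hk⟩ := exists_learner hε0 hε1 hrep h hn hT hN hprob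
  refine ⟨k, fun D _ => ?_⟩
  have hw1 : ∑ z, D.real {z} = 1 := by
    rw [sum_measureReal_singleton]
    simp
  have h1 := hk (fun z => D.real {z}) (fun z => measureReal_nonneg) hw1
  have h2 := sum_sampleWeight (n := n) hw1
  rw [← Finset.sum_filter_add_sum_filter_not Finset.univ (fun s : Fin n → X × O =>
    ∃ a A, ε < ∑ z, D.real {z} * excess (rep (k s z.1))
      (testValue (h a z.1) A (k s z.1)) z.2)] at h2
  rw [pi_real_eq_sum]
  simp only [not_exists, not_lt] at h2
  have h3 : ∀ a b c : ℝ, a + b = 1 → a ≤ 1 / 10 → b = c → 9 / 10 ≤ c := fun a b c _ _ _ => by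
    linarith
  refine h3 _ _ _ h2 ?_ ?_
  · convert h1
  · congr!

/-- The uniform predictor errs by at most `1 - 1 / ℓ`. -/
theorem real_sub_modeledLaw_barycenter_le [Nonempty O] (D : Measure (X × O))
    [IsProbabilityMeasure D] (B : Set (X × O)) :
    D.real B - (modeledLaw D fun _ => stdSimplex.barycenter).real B
      ≤ 1 - 1 / Fintype.card O := by
  classical
  have hw1 : ∑ z, D.real {z} = 1 := by
    rw [sum_measureReal_singleton]
    simp
  have hl : (1 : ℝ) ≤ Fintype.card O := by exact_mod_cast Fintype.card_pos (α := O)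
  have h0 : (0 : ℝ) ≤ 1 - 1 / Fintype.card O := by
    rw [sub_nonneg, div_le_one (by linarith)]
    exact hl
  rw [real_sub_modeledLaw_real]
  calc _ ≤ ∑ z, D.real {z} * (1 - 1 / Fintype.card O) := by
        refine Finset.sum_le_sum fun z _ => mul_le_mul_of_nonneg_left ?_ measureReal_nonneg
        have hb : ∀ o, (stdSimplex.barycenter : stdSimplex ℝ O) o = 1 / Fintype.card O := by
          intro o
          rw [one_div]
          rfl
        have h1 : ∀ o, (0 : ℝ) ≤ (stdSimplex.barycenter : stdSimplex ℝ O) o *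
            (if (z.1, o) ∈ B then 1 else 0) := fun o =>
          mul_nonneg (stdSimplex.zero_le _ _) (by split <;> simp)
        have h2 := Finset.single_le_sum (fun o _ => h1 o) (Finset.mem_univ z.2)
        have h3 := Finset.sum_nonneg fun o (_ : o ∈ Finset.univ) => h1 o
        simp only [excess]
        by_cases hz : (z.1, z.2) ∈ B
        · rw [if_pos hz] at h2 ⊢
          rw [hb, mul_one] at h2
          linarith
        · rw [if_neg hz]
          linarith
    _ = _ := by rw [← Finset.sum_mul, hw1, one_mul]

end Algorithms

/-! ### Sample sizes -/

section Numerics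

/-- The failure probability in terms of the number `n` of samples: the family of advantages shows
a number of behaviours with logarithm at most `(T + 1) (μ (d log (1 / θ) + 2 θ n) + B)` on `2 n`
points, where the cover of `C` is counted `μ` times and there are `2 ^ B` sets of triples (cell,
group membership, outcome). The choice of `θ` lets the term with `n` take half of the exponent. -/
theorem failure_le {ε θ μ : ℝ} {T d B n k : ℕ} (hε : 0 < ε) (hμ : μ = k) (hk : 0 < k)
    (hθ : θ = ε ^ 2 / (128 * (T + 1) * μ))
    (hn : 64 / ε ^ 2 * ((T + 1) * (μ * (d * Real.log θ⁻¹) + B) + 3) ≤ n) :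
    ((((θ⁻¹) ^ d * (1 + θ) ^ (2 * n)) ^ k * 2 ^ B) ^ (T + 1)) * Real.exp (-(n * ε ^ 2 / 32))
      ≤ 1 / 10 := by
  have hμ0 : 0 < μ := by rw [hμ]; exact_mod_cast hk
  have hθ0 : 0 < θ := by rw [hθ]; positivity
  have h1 : (θ⁻¹) ^ d * (1 + θ) ^ (2 * n) ≤ Real.exp (d * Real.log θ⁻¹ + 2 * n * θ) := by
    rw [Real.exp_add, Real.exp_nat_mul, Real.exp_log (by positivity)]
    refine mul_le_mul_of_nonneg_left ?_ (by positivity)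
    have h2 : (2 * n * θ : ℝ) = ((2 * n : ℕ) : ℝ) * θ := by push_cast; ring
    rw [h2, Real.exp_nat_mul]
    refine pow_le_pow_left₀ (by positivity) ?_ _
    linarith [Real.add_one_le_exp θ]
  have h2 : (2 : ℝ) ^ B ≤ Real.exp B := by
    rw [← mul_one (B : ℝ), Real.exp_nat_mul]
    refine pow_le_pow_left₀ (by norm_num) ?_ _
    linarith [Real.add_one_le_exp 1]
  have h3 : (((θ⁻¹) ^ d * (1 + θ) ^ (2 * n)) ^ k * 2 ^ B) ^ (T + 1)
      ≤ Real.exp ((T + 1) * (μ * (d * Real.log θ⁻¹ + 2 * n * θ) + B)) := by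
    have h4 : ((T : ℝ) + 1) = ((T + 1 : ℕ) : ℝ) := by push_cast; ring
    rw [h4, Real.exp_nat_mul]
    refine pow_le_pow_left₀ (by positivity) ?_ _
    rw [Real.exp_add, hμ, Real.exp_nat_mul]
    gcongr
  refine (mul_le_mul_of_nonneg_right h3 (Real.exp_pos _).le).trans ?_
  rw [← Real.exp_add]
  have h5 : ((T : ℝ) + 1) * (μ * (2 * n * θ)) = n * ε ^ 2 / 64 := by
    rw [hθ]
    field_simp
    ring
  have h6 : ((T + 1) * (μ * (d * Real.log θ⁻¹) + B) + 3 : ℝ) ≤ n * ε ^ 2 / 64 := by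
    rw [div_mul_eq_mul_div, div_le_iff₀ (by positivity)] at hn
    linarith
  have h7 : (T + 1) * (μ * (d * Real.log θ⁻¹ + 2 * n * θ) + B) + -(n * ε ^ 2 / 32) ≤ (-3 : ℝ) := by
    linarith
  refine (Real.exp_le_exp.2 h7).trans ?_
  rw [Real.exp_neg, one_div]
  refine inv_anti₀ (by norm_num) ?_
  have h8 : Real.exp 3 = Real.exp 1 ^ 3 := by rw [← Real.exp_nat_mul]; norm_num
  have h9 : (2.7 : ℝ) ^ 3 ≤ Real.exp 1 ^ 3 :=
    pow_le_pow_left₀ (by norm_num) (by linarith [Real.exp_one_gt_d9]) 3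
  rw [h8]
  refine le_trans ?_ h9
  norm_num

/-- A constant times a power of `b` with fixed exponent is absorbed by the first term of the sample
size, for `b = ℓ / ε`. -/
theorem le_rpow_add {b c a : ℝ} {l j : ℕ} (hb : 1 ≤ b) (ha : 0 ≤ a) (hac : a ≤ c) (hc : 6 ≤ c)
    (hj : 1 ≤ j) (hjc : (j : ℝ) ≤ c) :
    a * b ^ j * (6 * b) ^ l ≤ (c * b) ^ ((l : ℝ) + c) := by
  have hcb : 1 ≤ c * b := by nlinarith
  calc a * b ^ j * (6 * b) ^ l ≤ (c * b) ^ j * (c * b) ^ l := by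
        rw [mul_pow c b j]
        have : a ≤ c ^ j := hac.trans (le_self_pow₀ (by linarith) (by omega))
        gcongr
    _ = (c * b) ^ ((l : ℝ) + j) := by
        rw [← pow_add, ← Nat.cast_add, Real.rpow_natCast, add_comm]
    _ ≤ _ := Real.rpow_le_rpow_of_exponent_le hcb (by linarith)

/-- The bounds, in terms of `ℓ / ε`, on the number of values of a coordinate in the grid and on the
number of tests, namely the updates and the test that challenges the result. -/
theorem parameter_bounds {ε : ℝ} (hε : 0 < ε) (hε1 : ε < 1) {l : ℕ} (hl : 1 ≤ l) :
    1 ≤ l / ε ∧ 1 / ε ^ 2 ≤ (l / ε) ^ 2 ∧ (l : ℝ) ≤ l / ε ∧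
      ((⌈4 * l / ε⌉₊ + 1 : ℕ) : ℝ) ≤ 6 * (l / ε) ∧
      ((⌊64 * Real.log l / ε ^ 2⌋₊ + 1 : ℕ) : ℝ) + 1 ≤ 66 * (l / ε) ^ 2 := by
  have hl' : (1 : ℝ) ≤ l := by exact_mod_cast hl
  have h1 : (l : ℝ) ≤ l / ε := by
    rw [le_div_iff₀ hε]
    nlinarith
  have hb : 1 ≤ l / ε := hl'.trans h1
  have hlog : 0 ≤ Real.log l := Real.log_nonneg hl'
  refine ⟨hb, ?_, h1, ?_, ?_⟩
  · rw [div_pow]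
    have : (1 : ℝ) ≤ (l : ℝ) ^ 2 := one_le_pow₀ hl'
    gcongr
  · have := (Nat.ceil_lt_add_one (show 0 ≤ 4 * (l : ℝ) / ε by positivity)).le
    rw [mul_div_assoc] at this
    push_cast
    rw [mul_div_assoc]
    linarith
  · have h2 := Nat.floor_le (show 0 ≤ 64 * Real.log l / ε ^ 2 by positivity)
    have h3 : 64 * Real.log l / ε ^ 2 ≤ 64 * (l / ε) ^ 2 := by
      rw [div_pow, mul_div_assoc]
      have : Real.log l ≤ (l : ℝ) ^ 2 := by nlinarith [Real.log_le_self (by linarith : (0 : ℝ) ≤ l)]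
      gcongr
    push_cast
    nlinarith

end Numerics

/-! ### Learners with the stated sample sizes -/

section Main

open Classical

/-- The number of updates that boosting needs for accuracy `ε` with `l` outcomes. -/
noncomputable def numUpdates (ε : ℝ) (l : ℕ) : ℕ := ⌊64 * Real.log l / ε ^ 2⌋₊ + 1

/-- The cells of the grid that serves for accuracy `ε`. -/
abbrev GridCell (O : Type*) [Fintype O] (ε : ℝ) : Type _ :=
  O → Fin (⌈4 * Fintype.card O / ε⌉₊ + 1)

/-- The number of sets of triples (cell, group membership, outcome) is `2` to this power. -/
theorem card_cell_prod_le {O : Type*} [Fintype O] [Nonempty O] {ε : ℝ} (hε : 0 < ε)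
    (hε1 : ε < 1) :
    (Fintype.card (GridCell O ε × Bool × O) : ℝ)
      ≤ 2 * (Fintype.card O / ε) * (6 * (Fintype.card O / ε)) ^ Fintype.card O := by
  obtain ⟨hb, -, h1, h2, -⟩ := parameter_bounds hε hε1 (Fintype.card_pos (α := O))
  rw [Fintype.card_prod, Fintype.card_prod, Fintype.card_fun, Fintype.card_bool, Fintype.card_fin]
  push_cast at h2 ⊢
  rw [mul_comm]
  gcongr

/-- The learner with the grid and the number of updates fixed. The cover of the tests is bounded by
the `k`-th power of that of a family of VC dimension `d`: `k = 1` for tests that use a single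
member of the family, and `k` is the number of cells for tests that use one for each cell. -/
theorem exists_algorithm_of_le {X O H : Type*} [Fintype X] [Fintype O] [Nonempty O]
    [MeasurableSpace X] [MeasurableSpace O] [MeasurableSingletonClass X]
    [MeasurableSingletonClass O] [Nonempty H] {ε : ℝ} (hε0 : 0 < ε) (hε1 : ε < 1)
    (h : H → X → GridCell O ε → Bool) {d k n : ℕ} (hk : 0 < k)
    (hcover : ∀ (U : Finset X) (θ : ℝ), 0 < θ → θ ≤ 1 → ∃ R : Finset H,
      (R.card : ℝ) ≤ ((θ⁻¹) ^ d * (1 + θ) ^ U.card) ^ k ∧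
      ∀ a, ∃ r ∈ R, ∀ x ∈ U, ∀ j, h a x j = h r x j)
    (hn : 64 / ε ^ 2 * ((numUpdates ε (Fintype.card O) + 1) *
      (k * (d * Real.log (128 * (numUpdates ε (Fintype.card O) + 1) * k / ε ^ 2))
        + Fintype.card (GridCell O ε × Bool × O)) + 3) ≤ n) :
    ∃ (rep : GridCell O ε → stdSimplex ℝ O) (κ : (Fin n → X × O) → X → GridCell O ε),
      ∀ (D : Measure (X × O)) [IsProbabilityMeasure D],
        9 / 10 ≤ (Measure.pi fun _ => D).real {s | ∀ a A, ∑ z, D.real {z} *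
          excess (rep (κ s z.1)) (testValue (h a z.1) A (κ s z.1)) z.2 ≤ ε} := by
  have hl : (1 : ℝ) ≤ Fintype.card O := by exact_mod_cast Fintype.card_pos (α := O)
  have hk1 : (1 : ℝ) ≤ k := by exact_mod_cast hk
  set T := numUpdates ε (Fintype.card O) with hTdef
  have hT0 : (0 : ℝ) ≤ T := Nat.cast_nonneg T
  have hm : 0 < ⌈4 * Fintype.card O / ε⌉₊ := Nat.ceil_pos.2 (by positivity)
  obtain ⟨cell, rep, hrep⟩ := exists_cells (O := O) hm
  have hrep' : ∀ q, ∑ o, |rep (cell q) o - q o| ≤ ε / 4 := fun q => by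
    refine (hrep q).trans ?_
    have := Nat.le_ceil (4 * Fintype.card O / ε : ℝ)
    rw [div_le_iff₀ hε0] at this
    rw [div_le_iff₀ (by exact_mod_cast hm)]
    linarith
  have hlog : 0 ≤ Real.log (128 * (T + 1) * k / ε ^ 2) := by
    refine Real.log_nonneg ?_
    rw [le_div_iff₀ (by positivity)]
    have : ε ^ 2 ≤ 1 := pow_le_one₀ hε0.le hε1.le
    nlinarith [mul_nonneg hT0 (by linarith : (0 : ℝ) ≤ k)]
  have hn0 : 0 < n := by
    have : (0 : ℝ) < n := by
      refine lt_of_lt_of_le ?_ hn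
      generalize Real.log (128 * (T + 1) * k / ε ^ 2) = y at hlog
      positivity
    exact_mod_cast this
  set θ : ℝ := ε ^ 2 / (128 * (T + 1) * k) with hθ
  have hθ0 : 0 < θ := by positivity
  have hθ1 : θ ≤ 1 := by
    rw [hθ, div_le_one (by positivity)]
    have : ε ^ 2 ≤ 1 := pow_le_one₀ hε0.le hε1.le
    nlinarith [mul_nonneg hT0 (by linarith : (0 : ℝ) ≤ k)]
  have hθinv : θ⁻¹ = 128 * (T + 1) * k / ε ^ 2 := by rw [hθ, inv_div]
  rw [← hθinv] at hn
  have hT : 64 * Real.log (Fintype.card O) / ε ^ 2 < T := by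
    rw [hTdef, numUpdates]
    push_cast
    exact Nat.lt_floor_add_one _
  obtain ⟨κ, hκ⟩ := exists_algorithm hε0 hε1.le hrep' h hn0 hT
    (N := ((θ⁻¹) ^ d * (1 + θ) ^ (2 * n)) ^ k)
    (fun U hU => by
      obtain ⟨R, hR, hRc⟩ := hcover U θ hθ0 hθ1
      refine ⟨R, hR.trans ?_, hRc⟩
      have : (1 : ℝ) ≤ 1 + θ := by linarith
      gcongr)
    (failure_le hε0 rfl hk hθ hn)
  exact ⟨rep, κ, hκ⟩

/-- For constant membership tests, the cover of `C` is counted once, so that the term with the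
VC dimension is polynomial in `log ℓ` and `1 / ε`. The hypothesis on `ε` keeps `log ℓ / ε` away
from `1`, so that a power of it exceeds any constant. -/
theorem le_sampleSize_of_multiCalibrated {O : Type*} [Fintype O] [Nonempty O] {ε : ℝ}
    (hε : 0 < ε) (hε1 : ε < 1 - 1 / Fintype.card O) {c : ℝ} (hc : 10000 ≤ c) (d : ℕ) :
    64 / ε ^ 2 * ((numUpdates ε (Fintype.card O) + 1) *
      ((1 : ℕ) * (d * Real.log (128 * (numUpdates ε (Fintype.card O) + 1) * (1 : ℕ) / ε ^ 2))
        + Fintype.card (GridCell O ε × Bool × O)) + 3)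
      ≤ (sampleSize c ε (Fintype.card O) d : ℝ) := by
  have hl : (1 : ℝ) ≤ Fintype.card O := by exact_mod_cast Fintype.card_pos (α := O)
  have hlt1 : ε < 1 := by
    have : (0 : ℝ) < 1 / Fintype.card O := by positivity
    linarith
  have hB := card_cell_prod_le (O := O) hε hlt1
  obtain ⟨hb, hε2, hlb, -, hT⟩ := parameter_bounds hε hlt1 (Fintype.card_pos (α := O))
  have hu : Real.log 2 ≤ Real.log (Fintype.card O) ∧ 1.03 ≤ Real.log (Fintype.card O) / ε := by
    have hcard : Fintype.card O ≠ 1 := fun h => by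
      rw [h] at hε1
      norm_num at hε1
      linarith
    have hcard2 : 2 ≤ Fintype.card O := by
      have := Fintype.card_pos (α := O)
      omega
    refine ⟨Real.log_le_log (by norm_num) (by exact_mod_cast hcard2), ?_⟩
    rw [le_div_iff₀ hε]
    rcases hcard2.eq_or_lt with h | h
    · rw [← h] at hε1 ⊢
      push_cast at hε1 ⊢
      linarith [Real.log_two_gt_d9]
    · have := Real.log_le_log (by norm_num)
        (show (3 : ℝ) ≤ Fintype.card O by exact_mod_cast h)
      linarith [Real.log_three_gt_d9]
  set l := Fintype.card O with hldef
  set B : ℝ := ((Fintype.card (GridCell O ε × Bool × O) : ℕ) : ℝ)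
  set b : ℝ := l / ε with hbdef
  set T : ℝ := ((numUpdates ε l : ℕ) : ℝ) with hTdef
  have hT' : T + 1 ≤ 66 * b ^ 2 := hT
  have hT0 : 0 ≤ T := Nat.cast_nonneg _
  have hB0 : 0 ≤ B := Nat.cast_nonneg _
  set u : ℝ := Real.log l / ε with hudef
  have hu1 : 1 ≤ u := by linarith [hu.2]
  have hεu : 1 / ε ≤ 2 * u := by
    rw [hudef, ← mul_div_assoc]
    gcongr
    linarith [Real.log_two_gt_d9, hu.1]
  have hε2u : 1 / ε ^ 2 ≤ 4 * u ^ 2 := by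
    have := pow_le_pow_left₀ (by positivity) hεu 2
    rw [div_pow, one_pow, mul_pow] at this
    linarith
  have hTu : T + 1 ≤ 130 * u ^ 2 := by
    have h1 := Nat.floor_le (show 0 ≤ 64 * Real.log l / ε ^ 2 by
      have := Real.log_nonneg hl
      positivity)
    have h2 : 64 * Real.log l / ε ^ 2 = 64 * u * (1 / ε) := by
      rw [hudef]
      field_simp
    have h3 : 64 * u * (1 / ε) ≤ 64 * u * (2 * u) := by gcongr
    rw [h2] at h1
    rw [hTdef, numUpdates, h2]
    push_cast
    nlinarith
  -- the part without the VC dimension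
  have hfirst : 64 / ε ^ 2 * ((T + 1) * B + 3) ≤ (c * l / ε) ^ ((l : ℝ) + c) := by
    have h6b : 1 ≤ (6 * b) ^ l := one_le_pow₀ (by linarith)
    have hb3 : 1 ≤ b ^ 3 := one_le_pow₀ hb
    have h1 : (T + 1) * B + 3 ≤ 135 * b ^ 3 * (6 * b) ^ l := by
      have : (T + 1) * B ≤ (66 * b ^ 2) * (2 * b * (6 * b) ^ l) := by gcongr
      nlinarith [mul_le_mul hb3 h6b zero_le_one (by positivity)]
    calc 64 / ε ^ 2 * ((T + 1) * B + 3) = 64 * (1 / ε ^ 2) * ((T + 1) * B + 3) := by ring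
      _ ≤ 64 * b ^ 2 * (135 * b ^ 3 * (6 * b) ^ l) := by gcongr
      _ = 8640 * b ^ 5 * (6 * b) ^ l := by ring
      _ ≤ (c * b) ^ ((l : ℝ) + c) :=
          le_rpow_add hb (by norm_num) (by linarith) (by linarith) (by norm_num)
            (by norm_num; linarith)
      _ = _ := by rw [hbdef, mul_div_assoc]
  have hsecond : 64 / ε ^ 2 * ((T + 1) * (d * Real.log (128 * (T + 1) / ε ^ 2))) ≤ u ^ c * d := by
    have h1 : Real.log (128 * (T + 1) / ε ^ 2) ≤ 66560 * u ^ 4 := by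
      refine (Real.log_le_self (by positivity)).trans ?_
      calc 128 * (T + 1) / ε ^ 2 = 128 * (T + 1) * (1 / ε ^ 2) := by ring
        _ ≤ 128 * (130 * u ^ 2) * (4 * u ^ 2) := by gcongr
        _ = _ := by ring
    calc 64 / ε ^ 2 * ((T + 1) * (d * Real.log (128 * (T + 1) / ε ^ 2)))
        = 64 * (1 / ε ^ 2) * ((T + 1) * (d * Real.log (128 * (T + 1) / ε ^ 2))) := by ring
      _ ≤ 64 * (1 / ε ^ 2) * ((T + 1) * (d * (66560 * u ^ 4))) := by gcongr
      _ ≤ 64 * (4 * u ^ 2) * ((130 * u ^ 2) * (d * (66560 * u ^ 4))) := by gcongr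
      _ = 2215116800 * u ^ 8 * d := by ring
      _ ≤ u ^ c * d := by
          refine mul_le_mul_of_nonneg_right ?_ (Nat.cast_nonneg d)
          -- since `u ≥ 1.03`, a thousand further powers of `u` absorb the constant
          have h2 : (2215116800 : ℝ) ≤ u ^ 1000 := by
            have h3 : (300 : ℝ) ≤ u ^ 200 :=
              le_trans (by norm_num) (pow_le_pow_left₀ (by norm_num) hu.2 200)
            calc (2215116800 : ℝ) ≤ 300 ^ 5 := by norm_num
              _ ≤ (u ^ 200) ^ 5 := by gcongr
              _ = u ^ 1000 := by rw [← pow_mul]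
          calc 2215116800 * u ^ 8 ≤ u ^ 1000 * u ^ 8 := by gcongr
            _ = u ^ ((1008 : ℕ) : ℝ) := by rw [← pow_add, Real.rpow_natCast]
            _ ≤ u ^ c := Real.rpow_le_rpow_of_exponent_le hu1 (by push_cast; linarith)
  refine le_trans (le_of_eq ?_) ((add_le_add hfirst hsecond).trans (Nat.le_ceil _))
  push_cast
  rw [mul_one, one_mul]
  ring

/-- For membership tests that depend on the cell, the cover of `C` is counted once for each cell,
and the first term of the sample size absorbs it once the constant exceeds a multiple of the VC
dimension. -/
theorem le_sampleSize_of_strictlyMultiCalibrated {O : Type*} [Fintype O] [Nonempty O] {ε : ℝ}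
    (hε : 0 < ε) (hε1 : ε < 1) {c : ℝ} (d : ℕ) (hc : 40000000 * (d + 1) ≤ c) :
    64 / ε ^ 2 * ((numUpdates ε (Fintype.card O) + 1) *
      (Fintype.card (GridCell O ε) * (d * Real.log (128 * (numUpdates ε (Fintype.card O) + 1)
          * Fintype.card (GridCell O ε) / ε ^ 2))
        + Fintype.card (GridCell O ε × Bool × O)) + 3)
      ≤ (sampleSize c ε (Fintype.card O) d : ℝ) := by
  have hl : (1 : ℝ) ≤ Fintype.card O := by exact_mod_cast Fintype.card_pos (α := O)
  have hB := card_cell_prod_le (O := O) hε hε1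
  obtain ⟨hb, hε2, hlb, hm, hT⟩ := parameter_bounds hε hε1 (Fintype.card_pos (α := O))
  have hμ : (Fintype.card (GridCell O ε) : ℝ)
      = ((⌈4 * Fintype.card O / ε⌉₊ + 1 : ℕ) : ℝ) ^ Fintype.card O := by
    rw [Fintype.card_fun, Fintype.card_fin]
    push_cast
    rfl
  set l := Fintype.card O with hldef
  set B : ℝ := ((Fintype.card (GridCell O ε × Bool × O) : ℕ) : ℝ)
  set μ : ℝ := ((Fintype.card (GridCell O ε) : ℕ) : ℝ)
  set m : ℝ := ((⌈4 * l / ε⌉₊ + 1 : ℕ) : ℝ) with hmdef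
  set b : ℝ := l / ε with hbdef
  set T : ℝ := ((numUpdates ε l : ℕ) : ℝ) with hTdef
  have hT' : T + 1 ≤ 66 * b ^ 2 := hT
  have hT0 : 0 ≤ T := Nat.cast_nonneg _
  have hB0 : 0 ≤ B := Nat.cast_nonneg _
  have hm1 : 1 ≤ m := by
    rw [hmdef]
    exact_mod_cast Nat.succ_le_succ (Nat.zero_le _)
  have hμ1 : 1 ≤ μ := by rw [hμ]; exact one_le_pow₀ hm1
  have hμ6 : μ ≤ (6 * b) ^ l := by
    rw [hμ]
    gcongr
  have hlog : Real.log (128 * (T + 1) * μ / ε ^ 2) ≤ 8454 * b ^ 4 := by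
    rw [mul_div_right_comm, Real.log_mul (by positivity) (by positivity)]
    have h1 : Real.log (128 * (T + 1) / ε ^ 2) ≤ 8448 * b ^ 4 := by
      refine (Real.log_le_self (by positivity)).trans ?_
      calc 128 * (T + 1) / ε ^ 2 = 128 * (T + 1) * (1 / ε ^ 2) := by ring
        _ ≤ 128 * (66 * b ^ 2) * b ^ 2 := by gcongr
        _ = _ := by ring
    have h2 : Real.log μ ≤ 6 * b ^ 4 := by
      rw [hμ, Real.log_pow]
      calc l * Real.log m ≤ b * (6 * b) := by
            have := (Real.log_le_self (by linarith)).trans hm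
            gcongr
        _ = 6 * b ^ 2 := by ring
        _ ≤ 6 * b ^ 4 := by
            have := pow_le_pow_right₀ hb (show 2 ≤ 4 by norm_num)
            linarith
    linarith
  have h6b : 1 ≤ (6 * b) ^ l := one_le_pow₀ (by linarith)
  have hb4 : b ≤ b ^ 4 := le_self_pow₀ hb (by norm_num)
  have hb6 : 1 ≤ b ^ 6 := one_le_pow₀ hb
  have hd0 : (0 : ℝ) ≤ d := Nat.cast_nonneg d
  have hmain : (T + 1) * (μ * (d * Real.log (128 * (T + 1) * μ / ε ^ 2)) + B) + 3
      ≤ 600000 * (d + 1) * b ^ 6 * (6 * b) ^ l := by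
    have h1 : μ * (d * Real.log (128 * (T + 1) * μ / ε ^ 2)) + B
        ≤ (6 * b) ^ l * (8454 * (d + 1) * b ^ 4) := by
      have h2 : μ * (d * Real.log (128 * (T + 1) * μ / ε ^ 2))
          ≤ (6 * b) ^ l * (d * (8454 * b ^ 4)) := by
        refine mul_le_mul hμ6 (mul_le_mul_of_nonneg_left hlog hd0) ?_ (by positivity)
        refine mul_nonneg hd0 (Real.log_nonneg ?_)
        rw [le_div_iff₀ (by positivity)]
        have : ε ^ 2 ≤ 1 := pow_le_one₀ hε.le hε1.le
        nlinarith [mul_nonneg hT0 (by linarith : (0 : ℝ) ≤ μ)]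
      have h3 : 2 * b * (6 * b) ^ l ≤ (6 * b) ^ l * (8454 * b ^ 4) := by
        rw [mul_comm]
        gcongr
        linarith
      linarith
    have h4 : (T + 1) * (μ * (d * Real.log (128 * (T + 1) * μ / ε ^ 2)) + B)
        ≤ 66 * b ^ 2 * ((6 * b) ^ l * (8454 * (d + 1) * b ^ 4)) :=
      (mul_le_mul_of_nonneg_left h1 (by positivity)).trans (by gcongr)
    have h5 : (1 : ℝ) ≤ (d + 1) * b ^ 6 * (6 * b) ^ l := by
      have : (1 : ℝ) ≤ (d + 1) * b ^ 6 := one_le_mul_of_one_le_of_one_le (by linarith) hb6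
      exact one_le_mul_of_one_le_of_one_le this h6b
    linarith
  have hfirst : 64 / ε ^ 2 * ((T + 1) * (μ * (d * Real.log (128 * (T + 1) * μ / ε ^ 2)) + B) + 3)
      ≤ (c * l / ε) ^ ((l : ℝ) + c) := by
    calc _ ≤ 64 / ε ^ 2 * (600000 * (d + 1) * b ^ 6 * (6 * b) ^ l) := by gcongr
      _ = 64 * (1 / ε ^ 2) * (600000 * (d + 1) * b ^ 6 * (6 * b) ^ l) := by ring
      _ ≤ 64 * b ^ 2 * (600000 * (d + 1) * b ^ 6 * (6 * b) ^ l) := by gcongr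
      _ = 38400000 * (d + 1) * b ^ 8 * (6 * b) ^ l := by ring
      _ ≤ (c * b) ^ ((l : ℝ) + c) :=
          le_rpow_add hb (by positivity) (by linarith) (by linarith) (by norm_num)
            (by norm_num; linarith)
      _ = _ := by rw [hbdef, mul_div_assoc]
  have hsecond : 0 ≤ (Real.log l / ε) ^ c * d :=
    mul_nonneg (Real.rpow_nonneg (div_nonneg (Real.log_nonneg hl) hε.le) _) hd0
  exact (hfirst.trans (le_add_of_nonneg_right hsecond)).trans (Nat.le_ceil _)

/-- If `1 - 1 / ℓ ≤ ε`, then the uniform predictor serves; this covers the range in which the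
coefficient of the VC dimension is too small. -/
theorem exists_multiCalibrated_algorithm {X O : Type*} [Fintype X] [Fintype O] [Nonempty O]
    [MeasurableSpace X] [MeasurableSpace O] [MeasurableSingletonClass X]
    [MeasurableSingletonClass O] (C : Finset (X → Bool)) {ε c : ℝ} (hε : 0 < ε)
    (hc : 10000 ≤ c) :
    ∃ alg : (Fin (sampleSize c ε (Fintype.card O) (vcDimension C)) → X × O) → Predictor X O,
      ∀ (D : Measure (X × O)) [IsProbabilityMeasure D],
        9 / 10 ≤ (Measure.pi fun _ => D).real {s | MultiCalibrated C ε D (alg s)} := by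
  by_cases hε1 : 1 - 1 / (Fintype.card O : ℝ) ≤ ε
  · refine ⟨fun _ _ => stdSimplex.barycenter, fun D _ => ?_⟩
    have : MultiCalibrated C ε D (fun _ => stdSimplex.barycenter) :=
      multiCalibrated_of_le hε.le D _ fun c _ A =>
        (real_sub_modeledLaw_barycenter_le D _).trans hε1
    simp only [this, Set.ofPred_true, probReal_univ]
    norm_num
  push Not at hε1
  rcases C.eq_empty_or_nonempty with rfl | hC
  · refine ⟨fun _ _ => stdSimplex.barycenter, fun D _ => ?_⟩
    simp only [MultiCalibrated, Finset.notMem_empty, false_imp_iff, implies_true,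
      Set.ofPred_true, probReal_univ]
    norm_num
  have : Nonempty C := hC.to_subtype
  have hlt1 : ε < 1 := by
    have : (0 : ℝ) < 1 / Fintype.card O := by
      have := Fintype.card_pos (α := O)
      positivity
    linarith
  obtain ⟨rep, κ, hκ⟩ := exists_algorithm_of_le hε hlt1 (fun (a : C) x _ => a.1 x) one_pos
    (fun U θ h0 h1 => by
      obtain ⟨R, hR, hRc⟩ := exists_cover C U h0 h1
      refine ⟨R, by rwa [pow_one], fun a => ?_⟩
      obtain ⟨r, hr, h⟩ := hRc a
      exact ⟨r, hr, fun x hx _ => h x hx⟩)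
    (le_sampleSize_of_multiCalibrated hε hε1 hc (vcDimension C))
  refine ⟨fun s x => rep (κ s x), fun D _ => (hκ D).trans (measureReal_mono fun s hs => ?_)⟩
  exact multiCalibrated_of_le hε.le D _ fun a ha A =>
    real_sub_modeledLaw_real_le D rep (κ s) (fun x _ => a x) (hs ⟨a, ha⟩) A

theorem exists_strictlyMultiCalibrated_algorithm {X O : Type*} [Fintype X] [Fintype O]
    [Nonempty O] [MeasurableSpace X] [MeasurableSpace O] [MeasurableSingletonClass X]
    [MeasurableSingletonClass O] (C : Finset (X → Bool)) {ε c : ℝ} (hε : 0 < ε)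
    (hc : 40000000 * (vcDimension C + 1) ≤ c) :
    ∃ alg : (Fin (sampleSize c ε (Fintype.card O) (vcDimension C)) → X × O) → Predictor X O,
      ∀ (D : Measure (X × O)) [IsProbabilityMeasure D],
        9 / 10 ≤ (Measure.pi fun _ => D).real {s | StrictlyMultiCalibrated C ε D (alg s)} := by
  by_cases hε1 : 1 ≤ ε
  · refine ⟨fun _ _ => stdSimplex.barycenter, fun D _ => ?_⟩
    have : StrictlyMultiCalibrated C ε D (fun _ => stdSimplex.barycenter) :=
      strictlyMultiCalibrated_of_le hε.le D _ fun κ A =>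
        (real_sub_modeledLaw_barycenter_le D _).trans
          ((sub_le_self _ (by positivity)).trans hε1)
    simp only [this, Set.ofPred_true, probReal_univ]
    norm_num
  push Not at hε1
  rcases C.eq_empty_or_nonempty with rfl | hC
  · refine ⟨fun _ _ => stdSimplex.barycenter, fun D _ => ?_⟩
    have : StrictlyMultiCalibrated ∅ ε D (fun _ : X => (stdSimplex.barycenter : stdSimplex ℝ O)) :=
      strictlyMultiCalibrated_of_le hε.le D _ fun κ =>
        absurd (κ stdSimplex.barycenter).2 (Finset.notMem_empty _)
    simp only [this, Set.ofPred_true, probReal_univ]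
    norm_num
  have : Nonempty C := hC.to_subtype
  obtain ⟨rep, κ, hκ⟩ := exists_algorithm_of_le hε hε1
    (fun (a : GridCell O ε → C) x j => (a j).1 x) Fintype.card_pos
    (fun U θ h0 h1 => exists_cover_selectors C U h0 h1)
    (le_sampleSize_of_strictlyMultiCalibrated hε hε1 (vcDimension C) hc)
  refine ⟨fun s x => rep (κ s x), fun D _ => (hκ D).trans (measureReal_mono fun s hs => ?_)⟩
  exact strictlyMultiCalibrated_of_le hε.le D _ fun a A =>
    real_sub_modeledLaw_real_le D rep (κ s) (fun x j => (a (rep j)).1 x)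
      (hs fun j => a (rep j)) A

end Main

end MultiCalibration

theorem mainTheorem2 :
    -- multi-calibration, with an absolute constant
    (∃ c : ℝ, 0 < c ∧
      ∀ (X O : Type*) [Fintype X] [Fintype O] [Nonempty O]
        [MeasurableSpace X] [MeasurableSingletonClass X]
        [MeasurableSpace O] [MeasurableSingletonClass O]
        (C : Finset (X → Bool)) (ε : ℝ), 0 < ε →
        ∃ alg : (Fin (sampleSize c ε (Fintype.card O) (vcDimension C)) → X × O) → Predictor X O,
          ∀ (D : Measure (X × O)) [IsProbabilityMeasure D],
            9 / 10 ≤ (Measure.pi fun _ => D).real {s | MultiCalibrated C ε D (alg s)}) ∧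
    -- strict multi-calibration, with a constant that depends only on the fixed collection
    (∀ (X : Type*) [Fintype X] [MeasurableSpace X] [MeasurableSingletonClass X]
      (C : Finset (X → Bool)), ∃ c : ℝ, 0 < c ∧
      ∀ (O : Type*) [Fintype O] [Nonempty O] [MeasurableSpace O] [MeasurableSingletonClass O]
        (ε : ℝ), 0 < ε →
        ∃ alg : (Fin (sampleSize c ε (Fintype.card O) (vcDimension C)) → X × O) → Predictor X O,
          ∀ (D : Measure (X × O)) [IsProbabilityMeasure D],
            9 / 10 ≤ (Measure.pi fun _ => D).real
              {s | StrictlyMultiCalibrated C ε D (alg s)}) := by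
  refine ⟨⟨10000, by norm_num, fun X O _ _ _ _ _ _ _ C ε hε =>
    MultiCalibration.exists_multiCalibrated_algorithm C hε le_rfl⟩, fun X _ _ _ C =>
    ⟨40000000 * (vcDimension C + 1), by positivity, fun O _ _ _ _ ε hε =>
      MultiCalibration.exists_strictlyMultiCalibrated_algorithm C hε le_rfl⟩⟩
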